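/- Let $V:[-2,2]\to\mathbb R$ be $C^2$ on $[-2,2]$ and piecewise $C^3$ (that is, $C^3$ on each closed interval of some finite subdivision of $[-2,2]$). For a probability measure $\mu$ on $[-2,2]$ put $$I_V(\mu)=\int V\,d\mu-\iint\log|x-y|\,\mu(dx)\,\mu(dy)\in(-\infty,+\infty],\qquad I_V=\inf_{\mu\in\mathcal P([-2,2])}I_V(\mu),$$ where $\mathcal P([-2,2])$ is the set of Borel probability measures on $[-2,2]$. Suppose that the equilibrium measure of $V$ on $[-2,2]$, i.e. the minimizer of $I_V(\mu)$ over $\mathcal P([-2,2])$, has full support $[-2,2]$. Then $$\begin{aligned} I_V&=\int_{-2}^{2}\frac{V(x)\,dx}{\pi\sqrt{4-x^2}}-\int_0^1 t\left[\left(\int_{-2}^{2}\frac{xV'(tx)\,dx}{2\pi\sqrt{4-x^2}}\right)^2+\left(\int_{-2}^{2}\frac{V'(tx)\,dx}{\pi\sqrt{4-x^2}}\right)^2\right]dt\\ &=V(0)-\int_0^1\frac1t\left[-1+\left(1-\int_{-2}^{2}\frac{txV'(tx)\,dx}{2\pi\sqrt{4-x^2}}\right)^2+\left(\int_{-2}^{2}\frac{tV'(tx)\,dx}{\pi\sqrt{4-x^2}}\right)^2\right]dt,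 \end{aligned}$$ all the integrals being absolutely convergent. -/

import Mathlib

open Set MeasureTheory

noncomputable section

namespace LogPotential

/-- The interval `[-2, 2]`. -/
def J : Set ℝ := Icc (-2) 2

/-- `f` is piecewise of class `C^k` on `[a, b]`: there is a finite subdivision
`a = p 0 < p 1 < ... < p m = b` such that `f` is of class `C^k` on each closed piece. -/
def PiecewiseContDiffOn (k : ℕ) (f : ℝ → ℝ) (a b : ℝ) : Prop :=
  ∃ (m : ℕ) (p : ℕ → ℝ), p 0 = a ∧ p m = b ∧ (∀ i < m, p i < p (i + 1)) ∧
    ∀ i < m, ContDiffOn ℝ k f (Icc (p i) (p (i + 1)))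

/-- The derivative of a function on `[-2, 2]` (one-sided at the end points). -/
def derivJ (V : ℝ → ℝ) : ℝ → ℝ := derivWithin V J

/-- The logarithmic kernel `log |x - y|`, with value `-∞` on the diagonal. -/
def logDist (x y : ℝ) : EReal :=
  if x = y then ⊥ else ((Real.log |x - y| : ℝ) : EReal)

/-- The integral of an extended real valued function: the integral of its positive part minus
the integral of its negative part. -/
def extIntegral {α : Type*} [MeasurableSpace α] (μ : Measure α) (f : α → EReal) : EReal :=
  ((∫⁻ a, (f a).toENNReal ∂μ : ENNReal) : EReal) -
    ((∫⁻ a, (-f a).toENNReal ∂μ : ENNReal) : EReal)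

/-- The energy `I_V(μ) = ∫ V dμ - ∬ log |x - y| μ(dx) μ(dy)`, which may be `+∞`. -/
def energy (V : ℝ → ℝ) (μ : Measure ℝ) : EReal :=
  ((∫ x, V x ∂μ : ℝ) : EReal) - extIntegral (μ.prod μ) (fun q => logDist q.1 q.2)

/-- The set `P(S)` of Borel probability measures on `S`, regarded as measures on `ℝ`
carried by `S`. -/
def probOn (S : Set ℝ) : Set (Measure ℝ) :=
  {μ | IsProbabilityMeasure μ ∧ μ Sᶜ = 0}

/-- `I_V(S)`, the infimum of `I_V(μ)` over the probability measures on `S`. -/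
def minEnergy (V : ℝ → ℝ) (S : Set ℝ) : EReal :=
  ⨅ μ ∈ probOn S, energy V μ

/-- `μ` is the equilibrium measure of `V` on `S`: it minimizes `I_V` over the probability
measures on `S`. -/
def IsEquilibriumMeasure (V : ℝ → ℝ) (S : Set ℝ) (μ : Measure ℝ) : Prop :=
  μ ∈ probOn S ∧ ∀ ν ∈ probOn S, energy V μ ≤ energy V ν

/-- `f` is integrable against the arcsine law `ω(dx) = dx / (π √(4 - x²))` of `[-2, 2]`. -/
def ArcsineIntegrable (f : ℝ → ℝ) : Prop :=
  IntervalIntegrable (fun x => f x / (Real.pi * √(4 - x ^ 2))) volume (-2) 2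

/-- The integral `∫ f dω` against the arcsine law `ω(dx) = dx / (π √(4 - x²))` of `[-2, 2]`. -/
def arcsineIntegral (f : ℝ → ℝ) : ℝ :=
  ∫ x in (-2 : ℝ)..2, f x / (Real.pi * √(4 - x ^ 2))

/-- The integrand `t [(∫ x V'(t x) dω / 2)² + (∫ V'(t x) dω)²]`. -/
def integrand₁ (V : ℝ → ℝ) (t : ℝ) : ℝ :=
  t * ((arcsineIntegral (fun x => x * derivJ V (t * x) / 2)) ^ 2 +
    (arcsineIntegral (fun x => derivJ V (t * x))) ^ 2)

/-- The integrand `t⁻¹ [-1 + (1 - ∫ t x V'(t x) dω / 2)² + (∫ t V'(t x) dω)²]`. -/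
def integrand₂ (V : ℝ → ℝ) (t : ℝ) : ℝ :=
  1 / t * (-1 + (1 - arcsineIntegral (fun x => t * x * derivJ V (t * x) / 2)) ^ 2 +
    (arcsineIntegral (fun x => t * derivJ V (t * x))) ^ 2)

end LogPotential

end

noncomputable section

namespace LogPotential

open Real Filter Topology
open scoped Interval

/-! Put x = 2 cos θ, so that the arcsine law ω becomes dθ/π and the Chebyshev modes become cos nθ.
The kernel log |2 cos θ - 2 cos φ| is diagonal in these modes: n ≥ 1 has eigenvalue -1/n with
respect to ω, and the constant mode has eigenvalue 0 (`integral_log_two_cos_sub_mul_cos`).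

For an equilibrium measure μ with full support, V plus twice its logarithmic potential is constant
ω-almost everywhere (`ae_logPot_eq`). Let a_n be the mean over [0, π] of V(2 cos θ) cos nθ. Testing
this equation against mode n ≥ 1 gives ∫ cos nθ dμ = -(n/2) a_n; mode 0 gives I_V = (∫ V dμ + ∫ V
dω)/2. Expanding V in Chebyshev modes then yields I_V = a_0 - (1/2) Σ n a_n².

The sum is computed by dilation. Let a_n(t), b_n(t) be the cosine coefficients of V(t·), V'(t·).
Integration by parts in θ gives n a_n = t (b_{n-1} - b_{n+1}), and differentiation in t gives a_n' =
b_{n-1} + b_{n+1}. Hence (n a_n²/2)' = t (b_{n-1}² - b_{n+1}²), which telescopes over n to t (b_0² +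
b_1²) (`hasSum_half_sq_cosCoeff`). The second formula follows from a_0' = 2 b_1 and a_0(0) = V(0).
-/

/-! ### Arcsine integrals in the angular variable -/

theorem arcsineIntegral_eq_integral_cos (f : ℝ → ℝ) :
    arcsineIntegral f = π⁻¹ * ∫ θ in (0 : ℝ)..π, f (2 * cos θ) := by
  have h := Polynomial.Chebyshev.integral_measureT_eq_integral_cos (f := fun x => f (2 * x))
  rw [← h, Polynomial.Chebyshev.integral_measureT, arcsineIntegral]
  have h2 := intervalIntegral.smul_integral_comp_mul_left (a := -1) (b := 1)
    (fun x => f x / (π * √(4 - x ^ 2))) (2 : ℝ)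
  norm_num at h2
  rw [← h2, ← intervalIntegral.integral_const_mul, ← intervalIntegral.integral_const_mul]
  congr 1
  ext x
  have : √(4 - (2 * x) ^ 2) = 2 * √(1 - x ^ 2) := by
    rw [show 4 - (2 * x) ^ 2 = 2 ^ 2 * (1 - x ^ 2) by ring, Real.sqrt_mul (by norm_num),
      Real.sqrt_sq (by norm_num)]
  rw [this, div_eq_mul_inv, mul_inv, mul_inv, Real.sqrt_inv]
  ring

theorem arcsineIntegrable_of_continuousOn {f : ℝ → ℝ} (hf : ContinuousOn f J) :
    ArcsineIntegrable f := by
  have h := Polynomial.Chebyshev.intervalIntegrable_sqrt_one_sub_sq_inv.comp_mul_left (c := 2⁻¹)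
  norm_num at h
  unfold ArcsineIntegrable
  have h2 : IntervalIntegrable (fun x => f x * ((2 * π)⁻¹ * (√(1 - (1 / 2 * x) ^ 2))⁻¹))
      volume (-2) 2 := by
    refine (h.const_mul _).continuousOn_mul ?_
    rwa [uIcc_of_le (by norm_num)]
  refine h2.congr (fun x _ => ?_)
  have : √(4 - x ^ 2) = 2 * √(1 - (1 / 2 * x) ^ 2) := by
    rw [show 4 - x ^ 2 = 2 ^ 2 * (1 - (1 / 2 * x) ^ 2) by ring, Real.sqrt_mul (by norm_num),
      Real.sqrt_sq (by norm_num)]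
  simp only [this, div_eq_mul_inv, mul_inv]
  ring

/-! ### Fourier coefficients of log |2 sin| -/

theorem integral_cos_nat_mul {n : ℕ} (hn : n ≠ 0) : ∫ v in (0 : ℝ)..π, cos (n * v) = 0 := by
  have hn' : (n : ℝ) ≠ 0 := by exact_mod_cast hn
  rw [intervalIntegral.integral_comp_mul_left _ hn']
  simp

/-- The quotient D is 2 Σ cos((2k+1)v) over k ≤ n; only k = 0 pairs with cos v. It absorbs the pole
of cot v when log (2 sin v) is integrated by parts. -/
theorem exists_sin_two_mul_eq (n : ℕ) : ∃ D : ℝ → ℝ, Continuous D ∧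
    (∀ v, sin (2 * ((n + 1 : ℕ) : ℝ) * v) = sin v * D v) ∧
    ∫ v in (0 : ℝ)..π, cos v * D v = π := by
  induction n with
  | zero =>
    refine ⟨fun v => 2 * cos v, by fun_prop, fun v => ?_, ?_⟩
    · simp only [zero_add, Nat.cast_one, mul_one]
      rw [sin_two_mul]; ring
    · have : (fun v => cos v * (2 * cos v)) = fun v => 1 + cos ((2 : ℕ) * v) := by
        ext v; push_cast; rw [cos_two_mul]; ring
      rw [this, intervalIntegral.integral_add (by simp)
        (Continuous.intervalIntegrable (by fun_prop) _ _), integral_cos_nat_mul (by norm_num)]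
      simp
  | succ n ih =>
    obtain ⟨D, hD, h1, h2⟩ := ih
    refine ⟨fun v => D v + 2 * cos ((2 * n + 3 : ℕ) * v), by fun_prop, fun v => ?_, ?_⟩
    · rw [mul_add, ← h1]
      have e1 : 2 * ((n + 1 + 1 : ℕ) : ℝ) * v = (2 * n + 3 : ℕ) * v + v := by push_cast; ring
      have e2 : 2 * ((n + 1 : ℕ) : ℝ) * v = (2 * n + 3 : ℕ) * v - v := by push_cast; ring
      rw [e1, e2, sin_add, sin_sub]; ring
    · have : (fun v => cos v * (D v + 2 * cos ((2 * n + 3 : ℕ) * v))) =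
          fun v => cos v * D v + (cos ((2 * n + 4 : ℕ) * v) + cos ((2 * n + 2 : ℕ) * v)) := by
        ext v
        have e1 : ((2 * n + 4 : ℕ) : ℝ) * v = (2 * n + 3 : ℕ) * v + v := by push_cast; ring
        have e2 : ((2 * n + 2 : ℕ) : ℝ) * v = (2 * n + 3 : ℕ) * v - v := by push_cast; ring
        rw [e1, e2, cos_add, cos_sub]; ring
      rw [this, intervalIntegral.integral_add (Continuous.intervalIntegrable (by fun_prop) _ _)
        (Continuous.intervalIntegrable (by fun_prop) _ _), intervalIntegral.integral_add
        (Continuous.intervalIntegrable (by fun_prop) _ _)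
        (Continuous.intervalIntegrable (by fun_prop) _ _), h2, integral_cos_nat_mul (by omega),
        integral_cos_nat_mul (by omega)]
      simp

theorem intervalIntegrable_log_two_mul_sin (a b : ℝ) :
    IntervalIntegrable (fun v => log (2 * sin v)) volume a b := by
  have h : AnalyticOnNhd ℝ (fun v => 2 * sin v) univ := fun x _ => by fun_prop
  exact (h.mono (subset_univ _)).meromorphicOn.intervalIntegrable_log

theorem integral_log_two_mul_sin : ∫ v in (0 : ℝ)..π, log (2 * sin v) = 0 := by
  have : ∫ v in (0 : ℝ)..π, log (2 * sin v) = ∫ v in (0 : ℝ)..π, (log 2 + log (sin v)) := by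
    refine intervalIntegral.integral_congr_uIoo (fun v hv => ?_)
    rw [uIoo_of_le pi_pos.le] at hv
    exact log_mul (by norm_num) (sin_pos_of_mem_Ioo hv).ne'
  have h2 : IntervalIntegrable (fun v => log (sin v)) volume 0 π := intervalIntegrable_log_sin
  rw [this, intervalIntegral.integral_add (by simp) h2, integral_log_sin_zero_pi]
  simp; ring

theorem integral_log_two_mul_sin_mul_cos {n : ℕ} (hn : n ≠ 0) :
    ∫ v in (0 : ℝ)..π, log (2 * sin v) * cos (2 * n * v) = -(π / (2 * n)) := by
  obtain ⟨m, rfl⟩ := Nat.exists_eq_succ_of_ne_zero hn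
  obtain ⟨D, hD, h1, h2⟩ := exists_sin_two_mul_eq m
  have hn' : (m.succ : ℝ) ≠ 0 := by exact_mod_cast hn
  set c : ℝ := (m.succ : ℝ)
  have h1' : ∀ v, sin (2 * c * v) = sin v * D v := h1
  have hI : IntervalIntegrable (fun v => log (2 * sin v) * cos (2 * c * v)) volume 0 π :=
    (intervalIntegrable_log_two_mul_sin _ _).mul_continuousOn
      (Continuous.continuousOn (by fun_prop))
  have hI2 : IntervalIntegrable (fun v => (2 * c)⁻¹ * (cos v * D v)) volume 0 π :=
    Continuous.intervalIntegrable (by fun_prop) _ _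
  -- The primitive used below, rewritten through x log x, which is continuous at 0; thus the
  -- singular end points contribute nothing.
  have hcont : Continuous fun v => (4 * c)⁻¹ * ((2 * sin v) * log (2 * sin v) * D v) :=
    continuous_const.mul ((Real.continuous_mul_log.comp (by fun_prop : Continuous fun v =>
      2 * sin v)).mul hD)
  have key := intervalIntegral.integral_eq_sub_of_hasDerivAt_of_le (a := 0) (b := π)
    (f := fun v => (2 * c)⁻¹ * (log (2 * sin v) * sin (2 * c * v)))
    (f' := fun v => log (2 * sin v) * cos (2 * c * v) + (2 * c)⁻¹ * (cos v * D v))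
    pi_pos.le ?_ ?_ (hI.add hI2)
  · rw [intervalIntegral.integral_add hI hI2, intervalIntegral.integral_const_mul, h2] at key
    simp at key
    have e : π / (2 * c) = c⁻¹ * 2⁻¹ * π := by field_simp
    rw [e]
    linarith
  · refine hcont.continuousOn.congr (fun v _ => ?_)
    rw [h1']
    field_simp
    ring
  · intro v hv
    have hs := (sin_pos_of_mem_Ioo hv).ne'
    have hd := ((((hasDerivAt_sin v).const_mul 2).log (by simpa using hs)).mul
      (((hasDerivAt_id v).const_mul (2 * c)).sin)).const_mul (2 * c)⁻¹
    refine hd.congr_deriv ?_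
    simp only [id, h1']
    field_simp
    ring

/-- The boundary values of the logarithm of `|1 - z|` on the unit circle. -/
def logChord (u : ℝ) : ℝ := log (2 * sin (u / 2))

/-- `Real.log` ignores signs, so `logChord u` is log |2 sin(u/2)|, even and 2π-periodic. -/
theorem logChord_neg (u : ℝ) : logChord (-u) = logChord u := by
  simp [logChord, neg_div, log_neg_eq_log]

theorem logChord_periodic : Function.Periodic logChord (2 * π) := by
  intro u
  have : (u + 2 * π) / 2 = u / 2 + π := by ring
  simp [logChord, this, sin_add_pi, log_neg_eq_log]

theorem intervalIntegrable_logChord (a b : ℝ) : IntervalIntegrable logChord volume a b := by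
  have h : AnalyticOnNhd ℝ (fun v => 2 * sin (v / 2)) univ := fun x _ => by fun_prop
  exact (h.mono (subset_univ _)).meromorphicOn.intervalIntegrable_log

/-- At n = 0 the convention π / 0 = 0 gives the true value, the integral of log (2 sin) being zero,
so one formula serves all modes. -/
theorem integral_logChord_mul_cos (n : ℕ) :
    ∫ u in (0 : ℝ)..(0 + 2 * π), logChord u * cos (n * u) = -(π / n) := by
  have h := intervalIntegral.smul_integral_comp_mul_left (a := 0) (b := π)
    (fun u => logChord u * cos (n * u)) (2 : ℝ)
  rw [mul_zero] at h
  rw [zero_add, ← h]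
  have : (fun x => logChord (2 * x) * cos (n * (2 * x))) =
      fun x => log (2 * sin x) * cos (2 * n * x) := by
    ext x; simp only [logChord]; congr 2 <;> ring_nf
  rw [this]
  rcases eq_or_ne n 0 with rfl | hn
  · simp [integral_log_two_mul_sin]
  · rw [integral_log_two_mul_sin_mul_cos hn]
    have hn' : (n : ℝ) ≠ 0 := by exact_mod_cast hn
    simp only [smul_eq_mul]
    field_simp

theorem integral_logChord_mul_sin (n : ℕ) :
    ∫ u in (0 : ℝ)..(0 + 2 * π), logChord u * sin (n * u) = 0 := by
  have hper : Function.Periodic (fun u => logChord u * sin (n * u)) (2 * π) := by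
    intro u
    have : n * (u + 2 * π) = n * u + n * (2 * π) := by ring
    simp only [logChord_periodic u, this, sin_add_nat_mul_two_pi]
  rw [hper.intervalIntegral_add_eq 0 (-π)]
  have h := intervalIntegral.integral_comp_neg (a := -π) (b := π)
    (fun u => logChord u * sin (n * u))
  simp only [logChord_neg, mul_neg, sin_neg, neg_neg, intervalIntegral.integral_neg] at h
  rw [show -π + 2 * π = π by ring]
  linarith

/-! ### Diagonalization of the logarithmic kernel -/

/-- The product formula for cos θ - cos φ turns the kernel into two translates of one periodic
function, so its action on modes is a convolution. -/
theorem log_two_cos_sub {θ φ : ℝ} (h : cos θ ≠ cos φ) :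
    log (2 * cos θ - 2 * cos φ) = logChord (θ + φ) + logChord (θ - φ) := by
  have e : 2 * cos θ - 2 * cos φ = -((2 * sin ((θ + φ) / 2)) * (2 * sin ((θ - φ) / 2))) := by
    rw [← mul_sub, cos_sub_cos]; ring
  have hne : 2 * cos θ - 2 * cos φ ≠ 0 := by
    intro h0; apply h; linarith
  rw [e] at hne ⊢
  rw [log_neg_eq_log, log_mul (fun h => hne (by rw [h]; ring)) (fun h => hne (by rw [h]; ring))]
  rfl

theorem ae_log_two_cos_sub {φ : ℝ} (hφ : φ ∈ Icc 0 π) : ∀ᵐ θ : ℝ, θ ∈ Ι 0 π →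
    log (2 * cos θ - 2 * cos φ) = logChord (θ + φ) + logChord (θ - φ) := by
  have : ∀ᵐ θ : ℝ, θ ≠ φ := by simp [ae_iff, measure_singleton]
  filter_upwards [this] with θ h1 h2
  rw [uIoc_of_le pi_pos.le] at h2
  exact log_two_cos_sub (fun h => h1 (injOn_cos (Ioc_subset_Icc_self h2) hφ h))

theorem intervalIntegrable_log_two_cos_sub {φ : ℝ} (hφ : φ ∈ Icc 0 π) :
    IntervalIntegrable (fun θ => log (2 * cos θ - 2 * cos φ)) volume 0 π := by
  have h1 : IntervalIntegrable (fun θ => logChord (θ + φ)) volume 0 π := by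
    simpa using (intervalIntegrable_logChord (0 + φ) (π + φ)).comp_add_right φ
  have h2 : IntervalIntegrable (fun θ => logChord (θ - φ)) volume 0 π := by
    simpa using (intervalIntegrable_logChord (0 - φ) (π - φ)).comp_sub_right φ
  refine (h1.add h2).congr_ae ?_
  rw [Filter.EventuallyEq, ae_restrict_iff' measurableSet_uIoc]
  filter_upwards [ae_log_two_cos_sub hφ] with θ h h'
  simpa using (h h').symm

/-- The arcsine law diagonalizes the logarithmic kernel in the basis of Chebyshev polynomials. -/
theorem integral_log_two_cos_sub_mul_cos {φ : ℝ} (hφ : φ ∈ Icc 0 π) (n : ℕ) :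
    ∫ θ in (0 : ℝ)..π, log (2 * cos θ - 2 * cos φ) * cos (n * θ) = -(π / n) * cos (n * φ) := by
  have hint : ∀ a b c : ℝ, IntervalIntegrable (fun θ => logChord (θ + c) * cos (n * θ))
      volume a b := by
    intro a b c
    refine IntervalIntegrable.mul_continuousOn ?_ (Continuous.continuousOn (by fun_prop))
    simpa using (intervalIntegrable_logChord (a + c) (b + c)).comp_add_right c
  have hper : Function.Periodic (fun u => logChord u * cos (n * (u - φ))) (2 * π) := by
    intro u
    have : n * (u + 2 * π - φ) = n * (u - φ) + n * (2 * π) := by ring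
    simp only [logChord_periodic u, this, cos_add_nat_mul_two_pi]
  calc ∫ θ in (0 : ℝ)..π, log (2 * cos θ - 2 * cos φ) * cos (n * θ)
      = ∫ θ in (0 : ℝ)..π, (logChord (θ + φ) * cos (n * θ) +
          logChord (θ + -φ) * cos (n * θ)) := by
        refine intervalIntegral.integral_congr_ae ?_
        filter_upwards [ae_log_two_cos_sub hφ] with θ h h'
        rw [h h', ← sub_eq_add_neg]; ring
    -- By evenness, θ ↦ -θ carries the second translate to the first on [-π, 0]; the two halves then
    -- form a full period, over which φ can be shifted away.
    _ = (∫ θ in (0 : ℝ)..π, logChord (θ + φ) * cos (n * θ)) +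
          ∫ θ in (-π)..0, logChord (θ + φ) * cos (n * θ) := by
        rw [intervalIntegral.integral_add (hint _ _ _) (hint _ _ _)]
        congr 1
        have h := intervalIntegral.integral_comp_neg (a := 0) (b := π)
          (fun u => logChord (u + φ) * cos (n * u))
        rw [neg_zero] at h
        rw [← h]
        congr 1; ext θ
        rw [← logChord_neg, mul_neg, cos_neg]
        congr 2; ring
    _ = ∫ θ in (-π)..π, logChord (θ + φ) * cos (n * (θ + φ - φ)) := by
        rw [add_comm, intervalIntegral.integral_add_adjacent_intervals (hint _ _ _) (hint _ _ _)]
        simp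
    _ = ∫ u in (-π + φ)..(-π + φ + 2 * π), logChord u * cos (n * (u - φ)) := by
        rw [intervalIntegral.integral_comp_add_right
          (fun u => logChord u * cos (n * (u - φ))) φ]
        congr 1; ring
    _ = ∫ u in (0 : ℝ)..(0 + 2 * π), logChord u * cos (n * (u - φ)) :=
        hper.intervalIntegral_add_eq _ _
    _ = ∫ u in (0 : ℝ)..(0 + 2 * π), (cos (n * φ) * (logChord u * cos (n * u)) +
          sin (n * φ) * (logChord u * sin (n * u))) := by
        congr 1; ext u
        rw [mul_sub, cos_sub]; ring
    _ = _ := by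
        rw [intervalIntegral.integral_add, intervalIntegral.integral_const_mul,
          intervalIntegral.integral_const_mul, integral_logChord_mul_cos,
          integral_logChord_mul_sin]
        · ring
        · exact ((intervalIntegrable_logChord _ _).mul_continuousOn
            (Continuous.continuousOn (by fun_prop))).const_mul _
        · exact ((intervalIntegrable_logChord _ _).mul_continuousOn
            (Continuous.continuousOn (by fun_prop))).const_mul _

/-! ### The arcsine law as a measure -/

/-- The arcsine law of `[-2, 2]`. -/
def arcsineMeasure : Measure ℝ :=
  (ENNReal.ofReal π⁻¹ • volume.restrict (Ioc 0 π)).map (fun θ => 2 * cos θ)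

instance : IsProbabilityMeasure arcsineMeasure := by
  unfold arcsineMeasure
  have : IsProbabilityMeasure (ENNReal.ofReal π⁻¹ • volume.restrict (Ioc 0 π)) := by
    constructor
    simp [← ENNReal.ofReal_mul, pi_pos.le]
  exact Measure.isProbabilityMeasure_map (by fun_prop)

theorem two_mul_cos_mem_J (θ : ℝ) : 2 * cos θ ∈ J :=
  ⟨by linarith [neg_one_le_cos θ], by linarith [cos_le_one θ]⟩

theorem exists_two_mul_cos_eq {y : ℝ} (hy : y ∈ J) : ∃ φ ∈ Icc 0 π, 2 * cos φ = y := by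
  refine ⟨arccos (y / 2), ⟨arccos_nonneg _, arccos_le_pi _⟩, ?_⟩
  rw [cos_arccos (by linarith [hy.1]) (by linarith [hy.2])]
  ring

theorem arcsineMeasure_mem_probOn : arcsineMeasure ∈ probOn J := by
  refine ⟨inferInstance, ?_⟩
  rw [arcsineMeasure, Measure.map_apply (by fun_prop) (MeasurableSet.compl (s := J) measurableSet_Icc)]
  have : (fun θ => 2 * cos θ) ⁻¹' Jᶜ = ∅ := by
    ext θ; simp [two_mul_cos_mem_J]
  rw [this]; simp

theorem integral_arcsineMeasure {f : ℝ → ℝ} (hf : AEStronglyMeasurable f arcsineMeasure) :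
    ∫ x, f x ∂arcsineMeasure = π⁻¹ * ∫ θ in (0 : ℝ)..π, f (2 * cos θ) := by
  rw [arcsineMeasure, integral_map (by fun_prop) hf, integral_smul_measure,
    intervalIntegral.integral_of_le pi_pos.le, ENNReal.toReal_ofReal (by positivity)]
  rfl

theorem integrable_arcsineMeasure {f : ℝ → ℝ} (hf : AEStronglyMeasurable f arcsineMeasure)
    (h : IntervalIntegrable (fun θ => f (2 * cos θ)) volume 0 π) :
    Integrable f arcsineMeasure := by
  rw [arcsineMeasure, integrable_map_measure hf (by fun_prop)]
  refine Integrable.smul_measure ?_ (by simp)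
  rwa [intervalIntegrable_iff_integrableOn_Ioc_of_le pi_pos.le] at h

instance : NullSingletonClass arcsineMeasure := by
  constructor
  intro y
  rw [arcsineMeasure, Measure.map_apply (by fun_prop) (measurableSet_singleton y)]
  simp only [Measure.smul_apply, smul_eq_mul, mul_eq_zero]
  right
  rw [Measure.restrict_apply' measurableSet_Ioc]
  refine Set.Subsingleton.measure_zero ?_ _
  rintro a ⟨ha, ha'⟩ b ⟨hb, hb'⟩
  simp only [mem_preimage, mem_singleton_iff] at ha hb
  exact injOn_cos (Ioc_subset_Icc_self ha') (Ioc_subset_Icc_self hb') (by linarith)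

theorem ae_mem_J {ν : Measure ℝ} (hν : ν ∈ probOn J) : ∀ᵐ x ∂ν, x ∈ J := hν.2

theorem integrable_of_continuous {ν : Measure ℝ} (hν : ν ∈ probOn J) {f : ℝ → ℝ}
    (hf : Continuous f) : Integrable f ν := by
  have := hν.1
  obtain ⟨C, hC⟩ := (isCompact_Icc (a := (-2 : ℝ)) (b := 2)).exists_bound_of_continuousOn
    hf.continuousOn
  refine Integrable.of_bound hf.aestronglyMeasurable C ?_
  filter_upwards [ae_mem_J hν] with x hx using hC x hx

/-! ### Kernel, potential and energy -/

/-- The nonnegative logarithmic kernel `log 4 - log |x - y|` of `[-2, 2]`. -/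
def logKernel (x y : ℝ) : ENNReal :=
  if x = y then ⊤ else ENNReal.ofReal (log 4 - log (x - y))

theorem logKernel_comm (x y : ℝ) : logKernel x y = logKernel y x := by
  unfold logKernel
  rw [← log_neg_eq_log (x - y), neg_sub]
  simp [eq_comm]

/-- 4 is the diameter of `J`: on `J` the truncation `ENNReal.ofReal` in `logKernel` therefore loses
nothing. -/
theorem log_sub_le_log_four {x y : ℝ} (hx : x ∈ J) (hy : y ∈ J) : log (x - y) ≤ log 4 := by
  rcases eq_or_ne x y with rfl | h
  · simpa using log_nonneg (by norm_num : (1 : ℝ) ≤ 4)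
  · rw [← log_abs]
    refine log_le_log (abs_pos.2 (sub_ne_zero.2 h)) (abs_le.2 ?_)
    constructor <;> linarith [hx.1, hx.2, hy.1, hy.2]

theorem measurable_logKernel : Measurable (Function.uncurry logKernel) := by
  refine Measurable.ite (measurableSet_eq_fun measurable_fst measurable_snd) measurable_const ?_
  fun_prop

theorem measurable_logKernel_right (x : ℝ) : Measurable (logKernel x) :=
  measurable_logKernel.of_uncurry_left

/-- The value ⊤ on the diagonal is the limit there. Continuity is what lets Fatou's lemma give lower
semicontinuity of the potential. -/
theorem continuous_logKernel_left (y : ℝ) : Continuous fun x => logKernel x y := by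
  rw [continuous_iff_continuousAt]
  intro x
  rcases eq_or_ne x y with rfl | h
  · have h1 : Tendsto (fun z => ENNReal.ofReal (log 4 - log (z - x))) (𝓝[≠] x) (𝓝 ⊤) := by
      refine ENNReal.tendsto_ofReal_atTop.comp ?_
      refine tendsto_atTop_add_const_left _ _ (tendsto_neg_atBot_atTop.comp ?_)
      refine tendsto_log_nhdsNE_zero.comp ?_
      refine tendsto_nhdsWithin_iff.2 ⟨?_, ?_⟩
      · exact (Continuous.tendsto' (by fun_prop) x 0 (by simp)).mono_left nhdsWithin_le_nhds
      · filter_upwards [self_mem_nhdsWithin] with z hz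
        simpa [sub_eq_zero] using hz
    have h2 : Tendsto (fun z => logKernel z x) (𝓝[≠] x) (𝓝 ⊤) := by
      refine h1.congr' ?_
      filter_upwards [self_mem_nhdsWithin] with z hz
      have : z ≠ x := hz
      simp [logKernel, this]
    rw [← continuousWithinAt_compl_self]
    simpa [ContinuousWithinAt, logKernel] using h2
  · have h1 : ContinuousAt (fun z => ENNReal.ofReal (log 4 - log (z - y))) x := by
      refine ENNReal.continuous_ofReal.continuousAt.comp ?_
      have : x - y ≠ 0 := sub_ne_zero.2 h
      fun_prop (disch := assumption)
    refine h1.congr ?_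
    filter_upwards [isOpen_ne.mem_nhds h] with z hz
    have : z ≠ y := hz
    simp [logKernel, this]

/-- The shifted logarithmic potential of a measure. -/
def logPot (ν : Measure ℝ) (x : ℝ) : ENNReal := ∫⁻ y, logKernel x y ∂ν

theorem measurable_logPot (ν : Measure ℝ) [SFinite ν] : Measurable (logPot ν) :=
  measurable_logKernel.lintegral_prod_right'

theorem lowerSemicontinuous_logPot (ν : Measure ℝ) : LowerSemicontinuous (logPot ν) := by
  rw [lowerSemicontinuous_iff_le_liminf]
  intro x
  calc logPot ν x = ∫⁻ y, liminf (fun z => logKernel z y) (𝓝 x) ∂ν := by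
        refine lintegral_congr (fun y => ?_)
        exact ((continuous_logKernel_left y).tendsto x).liminf_eq.symm
    _ ≤ _ := lintegral_liminf_le (fun z => measurable_logKernel_right z)

/-- The shifted mutual energy of two measures. -/
def mutualEnergy (ν ρ : Measure ℝ) : ENNReal := ∫⁻ x, logPot ρ x ∂ν

theorem mutualEnergy_comm (ν ρ : Measure ℝ) [SFinite ν] [SFinite ρ] :
    mutualEnergy ν ρ = mutualEnergy ρ ν := by
  unfold mutualEnergy logPot
  rw [lintegral_lintegral_swap measurable_logKernel.aemeasurable]
  simp only [logKernel_comm]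

/-- Pointwise on `J`, kernel + log⁺ = log 4 + log⁻. The positive part has integral at most log 4, so
the subtraction of extended integrals is never ∞ - ∞. -/
theorem energy_eq {V : ℝ → ℝ} {ν : Measure ℝ} (hν : ν ∈ probOn J) :
    energy V ν = ((∫ x, V x ∂ν : ℝ) : EReal) + ((mutualEnergy ν ν : ENNReal) : EReal) -
      ((log 4 : ℝ) : EReal) := by
  have := hν.1
  have h4 : 0 ≤ log 4 := log_nonneg (by norm_num)
  set P := ∫⁻ q, (logDist q.1 q.2).toENNReal ∂(ν.prod ν) with hP
  set N := ∫⁻ q, (-logDist q.1 q.2).toENNReal ∂(ν.prod ν) with hN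
  have hJ : ∀ᵐ q ∂(ν.prod ν), q.1 ∈ J ∧ q.2 ∈ J := by
    have h1 := (Measure.quasiMeasurePreserving_fst (μ := ν) (ν := ν)).ae (ae_mem_J hν)
    have h2 := (Measure.quasiMeasurePreserving_snd (μ := ν) (ν := ν)).ae (ae_mem_J hν)
    filter_upwards [h1, h2] with q a b using ⟨a, b⟩
  have hmeas : Measurable fun q : ℝ × ℝ => logDist q.1 q.2 := by
    refine Measurable.ite (measurableSet_eq_fun measurable_fst measurable_snd)
      measurable_const ?_
    fun_prop
  have hPle : P ≤ ENNReal.ofReal (log 4) := by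
    calc P ≤ ∫⁻ q, ENNReal.ofReal (log 4) ∂(ν.prod ν) := by
          refine lintegral_mono_ae ?_
          filter_upwards [hJ] with q hq
          rcases eq_or_ne q.1 q.2 with h | h
          · simp [logDist, h]
          · simp only [logDist, h, if_false, log_abs]
            exact ENNReal.ofReal_le_ofReal (log_sub_le_log_four hq.1 hq.2)
      _ = _ := by simp
  have hsum : mutualEnergy ν ν + P = ENNReal.ofReal (log 4) + N := by
    have h1 : mutualEnergy ν ν = ∫⁻ q, logKernel q.1 q.2 ∂(ν.prod ν) :=
      (lintegral_prod _ measurable_logKernel.aemeasurable).symm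
    rw [h1, hP, hN, ← lintegral_add_right _ hmeas.ereal_toENNReal]
    have h2 : ENNReal.ofReal (log 4) = ∫⁻ q, ENNReal.ofReal (log 4) ∂(ν.prod ν) := by simp
    rw [h2, ← lintegral_add_left measurable_const]
    refine lintegral_congr_ae ?_
    filter_upwards [hJ] with q hq
    rcases eq_or_ne q.1 q.2 with h | h
    · simp [logDist, logKernel, h]
    · have hl := log_sub_le_log_four hq.1 hq.2
      simp only [logDist, logKernel, h, if_false, log_abs, ← EReal.coe_neg,
        EReal.toENNReal_of_ne_top (EReal.coe_ne_top _), EReal.toReal_coe]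
      rcases le_total 0 (log (q.1 - q.2)) with h0 | h0
      · rw [ENNReal.ofReal_of_nonpos (by linarith : -log (q.1 - q.2) ≤ 0), add_zero,
          ← ENNReal.ofReal_add (by linarith) h0]
        ring_nf
      · rw [ENNReal.ofReal_of_nonpos h0, add_zero, ← ENNReal.ofReal_add h4 (by linarith)]
        ring_nf
  have hPtop : P ≠ ⊤ := ne_top_of_le_ne_top (by simp) hPle
  unfold energy extIntegral
  rw [← hP, ← hN]
  clear_value P N
  generalize mutualEnergy ν ν = E at hsum
  lift P to NNReal using hPtop
  rcases eq_or_ne N ⊤ with rfl | hNtop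
  · have : E = ⊤ := by
      by_contra hE
      lift E to NNReal using hE
      simp [← ENNReal.coe_add] at hsum
    subst this
    rw [EReal.coe_ennreal_top, EReal.coe_nnreal_eq_coe_real, EReal.sub_top]
    simp
  · have hE : E ≠ ⊤ := by
      rintro rfl
      lift N to NNReal using hNtop
      rw [top_add] at hsum
      exact absurd hsum.symm (by finiteness)
    lift N to NNReal using hNtop
    lift E to NNReal using hE
    have h3 := congrArg ENNReal.toReal hsum
    rw [ENNReal.toReal_add (by simp) (by simp), ENNReal.toReal_add (by simp) (by simp),
      ENNReal.toReal_ofReal h4] at h3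
    simp only [ENNReal.coe_toReal] at h3
    simp only [EReal.coe_nnreal_eq_coe_real]
    rw [← EReal.coe_sub, ← EReal.coe_sub, ← EReal.coe_add, ← EReal.coe_sub]
    congr 1
    linarith

/-! ### Variations of the energy -/

theorem logPot_add_smul (μ ν : Measure ℝ) (a b : ENNReal) (x : ℝ) :
    logPot (a • μ + b • ν) x = a * logPot μ x + b * logPot ν x := by
  simp [logPot, lintegral_add_measure, lintegral_smul_measure]

theorem mutualEnergy_add_smul_self (μ ν : Measure ℝ) [SFinite μ] [SFinite ν] (a b : ENNReal) :
    mutualEnergy (a • μ + b • ν) (a • μ + b • ν) =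
      a * (a * mutualEnergy μ μ + b * mutualEnergy μ ν) +
        b * (a * mutualEnergy μ ν + b * mutualEnergy ν ν) := by
  have h : ∀ ρ : Measure ℝ, SFinite ρ → ∫⁻ x, logPot (a • μ + b • ν) x ∂ρ =
      a * mutualEnergy ρ μ + b * mutualEnergy ρ ν := by
    intro ρ _
    simp only [logPot_add_smul]
    rw [lintegral_add_left ((measurable_logPot μ).const_mul a),
      lintegral_const_mul _ (measurable_logPot μ), lintegral_const_mul _ (measurable_logPot ν)]
    rfl
  rw [mutualEnergy, lintegral_add_measure, lintegral_smul_measure, lintegral_smul_measure,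
    h μ inferInstance, h ν inferInstance, mutualEnergy_comm ν μ]
  rfl

theorem mix_mem_probOn {μ ν : Measure ℝ} (hμ : μ ∈ probOn J) (hν : ν ∈ probOn J) {s : ℝ}
    (h0 : 0 ≤ s) (h1 : s ≤ 1) :
    ENNReal.ofReal (1 - s) • μ + ENNReal.ofReal s • ν ∈ probOn J := by
  have := hμ.1
  have := hν.1
  refine ⟨⟨?_⟩, ?_⟩
  · simp only [Measure.add_apply, Measure.smul_apply, measure_univ, smul_eq_mul, mul_one]
    rw [← ENNReal.ofReal_add (by linarith) h0]
    simp
  · simp [hμ.2, hν.2]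

theorem nonneg_of_forall_quadratic {A B : ℝ} (h : ∀ s : ℝ, 0 < s → s ≤ 1 → 0 ≤ s * A + s ^ 2 * B) :
    0 ≤ A := by
  by_contra! hA
  have hB : 0 < |B| + 1 := by positivity
  -- Chosen so that s |B| ≤ -A/2, whence A + s B ≤ A/2 < 0.
  set s := min 1 (-A / (2 * (|B| + 1))) with hs
  have hs0 : 0 < s := lt_min one_pos (div_pos (by linarith) (by positivity))
  have hs1 : s * (|B| + 1) ≤ -A / 2 := by
    calc s * (|B| + 1) ≤ -A / (2 * (|B| + 1)) * (|B| + 1) := by gcongr; exact min_le_right _ _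
      _ = -A / 2 := by field_simp
  have h1 := h s hs0 (min_le_left _ _)
  have h2 : 0 ≤ A + s * B := by
    by_contra! h3
    nlinarith
  nlinarith [le_abs_self B]

theorem toReal_energy_le {V : ℝ → ℝ} {μ ν : Measure ℝ}
    (hμ : IsEquilibriumMeasure V J μ) (hν : ν ∈ probOn J) (hνE : mutualEnergy ν ν ≠ ⊤) :
    mutualEnergy μ μ ≠ ⊤ ∧
    ∫ x, V x ∂μ + (mutualEnergy μ μ).toReal ≤ ∫ x, V x ∂ν + (mutualEnergy ν ν).toReal := by
  have h := hμ.2 ν hν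
  rw [energy_eq hμ.1, energy_eq hν] at h
  generalize mutualEnergy μ μ = E at *
  generalize mutualEnergy ν ν = F at *
  lift F to NNReal using hνE
  have hE : E ≠ ⊤ := by
    rintro rfl
    simp only [EReal.coe_nnreal_eq_coe_real, EReal.coe_ennreal_top, EReal.coe_add_top,
      EReal.top_sub_coe] at h
    rw [← EReal.coe_add, ← EReal.coe_sub] at h
    exact EReal.coe_ne_top _ (top_le_iff.1 h)
  refine ⟨hE, ?_⟩
  lift E to NNReal using hE
  simp only [EReal.coe_nnreal_eq_coe_real] at h
  rw [← EReal.coe_add, ← EReal.coe_sub, ← EReal.coe_add, ← EReal.coe_sub,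
    EReal.coe_le_coe_iff] at h
  simpa using h

/-- The first variation of the energy at the equilibrium measure. -/
theorem first_variation {V : ℝ → ℝ} (hV : Continuous V) {μ ν : Measure ℝ}
    (hμ : IsEquilibriumMeasure V J μ) (hμE : mutualEnergy μ μ ≠ ⊤) (hν : ν ∈ probOn J)
    (hνE : mutualEnergy ν ν ≠ ⊤) (hM : mutualEnergy μ ν ≠ ⊤) :
    2 * (mutualEnergy μ μ).toReal + ∫ x, V x ∂μ ≤
      2 * (mutualEnergy μ ν).toReal + ∫ x, V x ∂ν := by
  have := hμ.1.1
  have := hν.1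
  rw [← sub_nonneg]
  -- Along (1 - s)μ + sν the energy is quadratic in s; B is the energy of the signed measure ν - μ,
  -- and the linear coefficient is the difference to be shown nonnegative.
  refine nonneg_of_forall_quadratic (B := (mutualEnergy μ μ).toReal -
    2 * (mutualEnergy μ ν).toReal + (mutualEnergy ν ν).toReal) (fun s h0 h1 => ?_)
  have hE := mutualEnergy_add_smul_self μ ν (ENNReal.ofReal (1 - s)) (ENNReal.ofReal s)
  have hint : ∫ x, V x ∂(ENNReal.ofReal (1 - s) • μ + ENNReal.ofReal s • ν) =
      (1 - s) * ∫ x, V x ∂μ + s * ∫ x, V x ∂ν := by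
    rw [integral_add_measure ((integrable_of_continuous hμ.1 hV).smul_measure (by simp))
      ((integrable_of_continuous hν hV).smul_measure (by simp)), integral_smul_measure,
      integral_smul_measure, ENNReal.toReal_ofReal (by linarith), ENNReal.toReal_ofReal h0.le]
    rfl
  have hfin : mutualEnergy (ENNReal.ofReal (1 - s) • μ + ENNReal.ofReal s • ν)
      (ENNReal.ofReal (1 - s) • μ + ENNReal.ofReal s • ν) ≠ ⊤ := by
    rw [hE]; finiteness
  have key := (toReal_energy_le hμ (mix_mem_probOn hμ.1 hν h0.le h1) hfin).2
  rw [hint, hE] at key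
  rw [ENNReal.toReal_add (by finiteness) (by finiteness), ENNReal.toReal_mul, ENNReal.toReal_mul,
    ENNReal.toReal_add (by finiteness) (by finiteness),
    ENNReal.toReal_add (by finiteness) (by finiteness), ENNReal.toReal_mul, ENNReal.toReal_mul,
    ENNReal.toReal_mul, ENNReal.toReal_mul,
    ENNReal.toReal_ofReal (by linarith), ENNReal.toReal_ofReal h0.le] at key
  linarith

/-! ### Chebyshev modes and the potential of the arcsine law -/

/-- The function `cos (n θ)` of `x = 2 cos θ`, i.e. the Chebyshev polynomial `T_n (x / 2)`. -/
def chebMode (n : ℕ) (x : ℝ) : ℝ := cos (n * arccos (x / 2))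

theorem continuous_chebMode (n : ℕ) : Continuous (chebMode n) := by
  unfold chebMode; fun_prop

theorem abs_chebMode_le (n : ℕ) (x : ℝ) : |chebMode n x| ≤ 1 := abs_cos_le_one _

theorem chebMode_two_mul_cos (n : ℕ) {θ : ℝ} (hθ : θ ∈ Icc 0 π) :
    chebMode n (2 * cos θ) = cos (n * θ) := by
  rw [chebMode, mul_div_cancel_left₀ _ (by norm_num), arccos_cos hθ.1 hθ.2]

theorem chebMode_zero (x : ℝ) : chebMode 0 x = 1 := by simp [chebMode]

theorem integral_mul_chebMode_arcsineMeasure {f : ℝ → ℝ} (hf : Measurable f) (n : ℕ) :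
    ∫ x, f x * chebMode n x ∂arcsineMeasure =
      π⁻¹ * ∫ θ in (0 : ℝ)..π, f (2 * cos θ) * cos (n * θ) := by
  have hm : Measurable fun x => f x * chebMode n x := hf.mul (continuous_chebMode n).measurable
  rw [integral_arcsineMeasure hm.aestronglyMeasurable]
  congr 1
  refine intervalIntegral.integral_congr (fun θ hθ => ?_)
  rw [uIcc_of_le pi_pos.le] at hθ
  simp only [chebMode_two_mul_cos n hθ]

theorem integrable_log_sub_arcsineMeasure {y : ℝ} (hy : y ∈ J) :
    Integrable (fun x => log 4 - log (x - y)) arcsineMeasure := by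
  obtain ⟨φ, hφ, rfl⟩ := exists_two_mul_cos_eq hy
  refine integrable_arcsineMeasure (Measurable.aestronglyMeasurable (by fun_prop)) ?_
  exact IntervalIntegrable.sub (by simp) (intervalIntegrable_log_two_cos_sub hφ)

theorem logKernel_ae_eq (y : ℝ) : ∀ᵐ x ∂arcsineMeasure,
    logKernel x y = ENNReal.ofReal (log 4 - log (x - y)) := by
  have : ∀ᵐ x ∂arcsineMeasure, x ≠ y := by simp [ae_iff, measure_singleton]
  filter_upwards [this] with x hx
  simp [logKernel, hx]

theorem integral_logKernel_mul_chebMode {y : ℝ} (hy : y ∈ J) (n : ℕ) :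
    ∫ x, (logKernel x y).toReal * chebMode n x ∂arcsineMeasure =
      log 4 * (π⁻¹ * ∫ θ in (0 : ℝ)..π, cos (n * θ)) + chebMode n y / n := by
  have h1 : ∫ x, (logKernel x y).toReal * chebMode n x ∂arcsineMeasure =
      ∫ x, (log 4 - log (x - y)) * chebMode n x ∂arcsineMeasure := by
    refine integral_congr_ae ?_
    filter_upwards [logKernel_ae_eq y, ae_mem_J arcsineMeasure_mem_probOn] with x hx hJ
    rw [hx, ENNReal.toReal_ofReal (sub_nonneg.2 (log_sub_le_log_four hJ hy))]
  rw [h1, integral_mul_chebMode_arcsineMeasure (by fun_prop)]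
  obtain ⟨φ, hφ, rfl⟩ := exists_two_mul_cos_eq hy
  simp only [sub_mul]
  rw [intervalIntegral.integral_sub (Continuous.intervalIntegrable (by fun_prop) _ _)
    ((intervalIntegrable_log_two_cos_sub hφ).mul_continuousOn
      (Continuous.continuousOn (by fun_prop))), integral_log_two_cos_sub_mul_cos hφ,
    intervalIntegral.integral_const_mul, chebMode_two_mul_cos n hφ]
  field_simp
  ring

theorem lintegral_logKernel_arcsineMeasure {y : ℝ} (hy : y ∈ J) :
    ∫⁻ x, logKernel x y ∂arcsineMeasure = ENNReal.ofReal (log 4) := by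
  have hne : ∫⁻ x, logKernel x y ∂arcsineMeasure ≠ ⊤ := by
    rw [lintegral_congr_ae (logKernel_ae_eq y)]
    exact (integrable_log_sub_arcsineMeasure hy).lintegral_lt_top.ne
  have hm : Measurable fun x => logKernel x y := measurable_logKernel.of_uncurry_right
  have h := integral_logKernel_mul_chebMode hy 0
  simp only [chebMode_zero, mul_one] at h
  rw [integral_toReal hm.aemeasurable (ae_lt_top hm hne)] at h
  rw [← ENNReal.ofReal_toReal hne, h]
  simp

theorem logPot_arcsineMeasure {y : ℝ} (hy : y ∈ J) :
    logPot arcsineMeasure y = ENNReal.ofReal (log 4) := by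
  rw [← lintegral_logKernel_arcsineMeasure hy]
  simp only [logPot, logKernel_comm]

/-- The shifted potential of the arcsine law is constant on `J`. Hence this law is always an
admissible competitor, with finite mutual energy against every probability measure on `J`. -/
theorem mutualEnergy_arcsineMeasure {ν : Measure ℝ} (hν : ν ∈ probOn J) :
    mutualEnergy ν arcsineMeasure = ENNReal.ofReal (log 4) := by
  have := hν.1
  rw [mutualEnergy, lintegral_congr_ae (g := fun _ => ENNReal.ofReal (log 4))]
  · simp
  · filter_upwards [ae_mem_J hν] with x hx using logPot_arcsineMeasure hx

theorem mutualEnergy_self_ne_top {V : ℝ → ℝ} {μ : Measure ℝ}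
    (hμ : IsEquilibriumMeasure V J μ) : mutualEnergy μ μ ≠ ⊤ := by
  refine (toReal_energy_le hμ arcsineMeasure_mem_probOn ?_).1
  rw [mutualEnergy_arcsineMeasure arcsineMeasure_mem_probOn]
  simp

/-! ### The Euler-Lagrange equation -/

/-- The constant value of `V + 2 logPot μ` on the support of the equilibrium measure. -/
def robin (V : ℝ → ℝ) (μ : Measure ℝ) : ℝ := 2 * (mutualEnergy μ μ).toReal + ∫ x, V x ∂μ

/-- If the inequality failed on a set A of positive measure, μ conditioned on A would violate
`first_variation`. Conditioning multiplies by at most 1/μ(A), so all energies stay finite. -/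
theorem ae_robin_le {V : ℝ → ℝ} (hV : Continuous V) {μ : Measure ℝ}
    (hμ : IsEquilibriumMeasure V J μ) :
    ∀ᵐ x ∂μ, (robin V μ - V x) / 2 ≤ (logPot μ x).toReal := by
  have := hμ.1.1
  have hE := mutualEnergy_self_ne_top hμ
  have hPm := measurable_logPot μ
  set A := {x | (logPot μ x).toReal < (robin V μ - V x) / 2} with hA
  have hAm : MeasurableSet A := measurableSet_lt hPm.ennreal_toReal (by fun_prop)
  suffices h : μ A = 0 by
    rw [ae_iff]; simpa using h
  by_contra hA0
  have hfin : (μ A)⁻¹ ≠ ⊤ := by simpa using hA0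
  set ν := ProbabilityTheory.cond μ A with hνdef
  have hνp : IsProbabilityMeasure ν := ProbabilityTheory.cond_isProbabilityMeasure hA0
  have hνμ : ν ≪ μ := ProbabilityTheory.cond_absolutelyContinuous
  have hν : ν ∈ probOn J := ⟨hνp, hνμ hμ.1.2⟩
  have hle : ∀ f : ℝ → ENNReal, ∫⁻ x, f x ∂ν ≤ (μ A)⁻¹ * ∫⁻ x, f x ∂μ := by
    intro f
    rw [hνdef, ProbabilityTheory.cond, lintegral_smul_measure, smul_eq_mul]
    gcongr
    exact Measure.restrict_le_self
  have hM : mutualEnergy ν μ ≠ ⊤ := ne_top_of_le_ne_top (by finiteness) (hle (logPot μ))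
  have hνE : mutualEnergy ν ν ≠ ⊤ := by
    have h1 : mutualEnergy ν ν ≤ ∫⁻ x, (μ A)⁻¹ * logPot μ x ∂ν :=
      lintegral_mono (fun x => hle (logKernel x))
    rw [lintegral_const_mul _ hPm] at h1
    exact ne_top_of_le_ne_top (ENNReal.mul_ne_top hfin hM) h1
  have key := first_variation hV hμ hE hν hνE (by rwa [mutualEnergy_comm])
  rw [mutualEnergy_comm μ ν] at key
  have hPlt : ∀ᵐ x ∂ν, logPot μ x < ⊤ := ae_lt_top hPm hM
  have hPi : Integrable (fun x => (logPot μ x).toReal) ν :=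
    integrable_toReal_of_lintegral_ne_top hPm.aemeasurable hM
  have hci : Integrable (fun x => (robin V μ - V x) / 2) ν :=
    integrable_of_continuous hν (by fun_prop)
  have hVi : Integrable V ν := integrable_of_continuous hν hV
  have h1 : ∫ x, ((robin V μ - V x) / 2 - (logPot μ x).toReal) ∂ν ≤ 0 := by
    rw [integral_sub hci hPi, integral_toReal hPm.aemeasurable hPlt, integral_div,
      integral_sub (by simp) hVi]
    simp only [integral_const, probReal_univ, smul_eq_mul, one_mul]
    unfold robin mutualEnergy at *
    linarith
  have hpos : ∀ᵐ x ∂ν, 0 < (robin V μ - V x) / 2 - (logPot μ x).toReal := by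
    have : ∀ᵐ x ∂ν, x ∈ A := ProbabilityTheory.ae_cond_mem hAm
    filter_upwards [this] with x hx
    exact sub_pos.2 hx
  have hnn : 0 ≤ᵐ[ν] fun x => (robin V μ - V x) / 2 - (logPot μ x).toReal := by
    filter_upwards [hpos] with x hx using hx.le
  have h0 := (integral_eq_zero_iff_of_nonneg_ae hnn (hci.sub hPi)).1
    (le_antisymm h1 (integral_nonneg_of_ae hnn))
  have : ∀ᵐ x ∂ν, False := by
    filter_upwards [hpos, h0] with x hx hx0
    exact hx.ne' hx0
  simp at this
  exact hνp.ne_zero ν this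

/-- The Euler-Lagrange inequality on the support of the equilibrium measure. -/
theorem logPot_le_of_mem_support {V : ℝ → ℝ} (hV : Continuous V) {μ : Measure ℝ}
    (hμ : IsEquilibriumMeasure V J μ) {x : ℝ} (hx : x ∈ μ.support) :
    0 ≤ (robin V μ - V x) / 2 ∧ logPot μ x ≤ ENNReal.ofReal ((robin V μ - V x) / 2) := by
  have := hμ.1.1
  have hE := mutualEnergy_self_ne_top hμ
  have hPm := measurable_logPot μ
  have hPlt : ∀ᵐ x ∂μ, logPot μ x < ⊤ := ae_lt_top hPm hE
  have hPi : Integrable (fun x => (logPot μ x).toReal) μ :=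
    integrable_toReal_of_lintegral_ne_top hPm.aemeasurable hE
  have hci : Integrable (fun x => (robin V μ - V x) / 2) μ :=
    integrable_of_continuous hμ.1 (by fun_prop)
  have hVi : Integrable V μ := integrable_of_continuous hμ.1 hV
  have heq : ∫ x, (robin V μ - V x) / 2 ∂μ = ∫ x, (logPot μ x).toReal ∂μ := by
    rw [integral_toReal hPm.aemeasurable hPlt, integral_div, integral_sub (by simp) hVi]
    simp only [integral_const, probReal_univ, smul_eq_mul, one_mul]
    unfold robin mutualEnergy
    ring
  -- Both sides have the same μ-integral by the definition of `robin`, so the inequality is an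
  -- equality μ-almost everywhere.
  have hae := (integral_eq_iff_of_ae_le hci hPi (ae_robin_le hV hμ)).1 heq
  set C := {x | 0 ≤ (robin V μ - V x) / 2} ∩
    {x | logPot μ x ≤ ENNReal.ofReal ((robin V μ - V x) / 2)} with hC
  -- Lower semicontinuity of the potential makes C closed; having full measure, it contains the
  -- support. The sign condition in C guards against truncation by `ENNReal.ofReal`.
  have hCc : IsClosed C := by
    refine (isClosed_le continuous_const (by fun_prop)).inter ?_
    exact (lowerSemicontinuous_iff_isClosed_epigraph.1 (lowerSemicontinuous_logPot μ)).preimage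
      (continuous_id.prodMk (ENNReal.continuous_ofReal.comp (by fun_prop)) :
        Continuous fun x => (x, ENNReal.ofReal ((robin V μ - V x) / 2)))
  refine Measure.support_subset_of_isClosed hCc ?_ hx
  filter_upwards [hae, hPlt] with x h1 h2
  refine ⟨?_, ?_⟩
  · simp only [mem_ofPred_eq, h1]; exact ENNReal.toReal_nonneg
  · simp only [mem_ofPred_eq, h1, ENNReal.ofReal_toReal h2.ne, le_refl]

/-- Full support gives ≤ on all of `J`, while the first variation towards the arcsine law gives ≥
for the arcsine integrals. The exceptional set is thus null for the law under which the modes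
diagonalize the kernel. -/
theorem ae_logPot_eq {V : ℝ → ℝ} (hV : Continuous V) {μ : Measure ℝ}
    (hμ : IsEquilibriumMeasure V J μ) (hsupp : J ⊆ μ.support) :
    ∀ᵐ x ∂arcsineMeasure, (logPot μ x).toReal = (robin V μ - V x) / 2 := by
  have := hμ.1.1
  have hω := arcsineMeasure_mem_probOn
  have hPm := measurable_logPot μ
  have hM : mutualEnergy arcsineMeasure μ ≠ ⊤ := by
    rw [mutualEnergy_comm, mutualEnergy_arcsineMeasure hμ.1]; simp
  have hPlt : ∀ᵐ x ∂arcsineMeasure, logPot μ x < ⊤ := ae_lt_top hPm hM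
  have hPi : Integrable (fun x => (logPot μ x).toReal) arcsineMeasure :=
    integrable_toReal_of_lintegral_ne_top hPm.aemeasurable hM
  have hci : Integrable (fun x => (robin V μ - V x) / 2) arcsineMeasure :=
    integrable_of_continuous hω (by fun_prop)
  have hVi : Integrable V arcsineMeasure := integrable_of_continuous hω hV
  have hle : ∀ᵐ x ∂arcsineMeasure, (logPot μ x).toReal ≤ (robin V μ - V x) / 2 := by
    filter_upwards [ae_mem_J hω] with x hx
    obtain ⟨h0, h1⟩ := logPot_le_of_mem_support hV hμ (hsupp hx)
    exact ENNReal.toReal_le_of_le_ofReal h0 h1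
  refine (integral_eq_iff_of_ae_le hPi hci hle).1 (le_antisymm (integral_mono_ae hPi hci hle) ?_)
  have key := first_variation hV hμ (mutualEnergy_self_ne_top hμ) hω
    (by rw [mutualEnergy_arcsineMeasure hω]; simp) (by rwa [mutualEnergy_comm])
  rw [mutualEnergy_comm μ arcsineMeasure] at key
  rw [integral_toReal hPm.aemeasurable hPlt, integral_div, integral_sub (by simp) hVi]
  simp only [integral_const, probReal_univ, smul_eq_mul, one_mul]
  unfold robin
  unfold mutualEnergy at *
  linarith

/-! ### Moments of the equilibrium measure -/

/-- Testing the Euler-Lagrange equation against the Chebyshev modes. -/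
theorem moment_identity {V : ℝ → ℝ} (hV : Continuous V) {μ : Measure ℝ}
    (hμ : IsEquilibriumMeasure V J μ) (hsupp : J ⊆ μ.support) (n : ℕ) :
    log 4 * (π⁻¹ * ∫ θ in (0 : ℝ)..π, cos (n * θ)) + (∫ y, chebMode n y ∂μ) / n =
      π⁻¹ * ∫ θ in (0 : ℝ)..π, (robin V μ - V (2 * cos θ)) / 2 * cos (n * θ) := by
  have := hμ.1.1
  have hω := arcsineMeasure_mem_probOn
  have hM : ∫⁻ q, logKernel q.1 q.2 ∂(arcsineMeasure.prod μ) ≠ ⊤ := by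
    have h : mutualEnergy arcsineMeasure μ = ∫⁻ q, logKernel q.1 q.2 ∂(arcsineMeasure.prod μ) :=
      (lintegral_prod _ measurable_logKernel.aemeasurable).symm
    rw [← h]
    rw [mutualEnergy_comm, mutualEnergy_arcsineMeasure hμ.1]; simp
  have hK : Integrable (fun q : ℝ × ℝ => (logKernel q.1 q.2).toReal * chebMode n q.1)
      (arcsineMeasure.prod μ) := by
    refine (integrable_toReal_of_lintegral_ne_top measurable_logKernel.aemeasurable hM).mul_bdd
      (c := 1) ?_ (ae_of_all _ fun q => abs_chebMode_le n q.1)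
    exact ((continuous_chebMode n).comp continuous_fst).aestronglyMeasurable
  -- Integrating over μ first gives the potential, hence V; integrating over the arcsine law first
  -- gives the eigenvalue relation for the mode.
  have hswap := integral_integral_swap
    (f := fun x y => (logKernel x y).toReal * chebMode n x) hK
  have h1 : ∫ x, ∫ y, (logKernel x y).toReal * chebMode n x ∂μ ∂arcsineMeasure =
      ∫ x, (robin V μ - V x) / 2 * chebMode n x ∂arcsineMeasure := by
    refine integral_congr_ae ?_
    filter_upwards [ae_mem_J hω, ae_logPot_eq hV hμ hsupp] with x hx h
    have hm : Measurable (logKernel x) := measurable_logKernel_right x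
    have hlt : logPot μ x < ⊤ :=
      (logPot_le_of_mem_support hV hμ (hsupp hx)).2.trans_lt ENNReal.ofReal_lt_top
    rw [integral_mul_const, integral_toReal hm.aemeasurable (ae_lt_top hm hlt.ne), ← h]
    rfl
  have h2 : ∫ y, ∫ x, (logKernel x y).toReal * chebMode n x ∂arcsineMeasure ∂μ =
      ∫ y, (log 4 * (π⁻¹ * ∫ θ in (0 : ℝ)..π, cos (n * θ)) + chebMode n y / n) ∂μ := by
    refine integral_congr_ae ?_
    filter_upwards [ae_mem_J hμ.1] with y hy using integral_logKernel_mul_chebMode hy n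
  rw [h1, h2, integral_mul_chebMode_arcsineMeasure (by fun_prop), integral_add (integrable_const _)
    ((integrable_of_continuous hμ.1 (continuous_chebMode n)).div_const _), integral_div] at hswap
  rw [hswap]
  simp

/-- For n ≠ 0 the constants log 4 and `robin` are orthogonal to the mode and drop out. -/
theorem integral_chebMode_equilibrium {V : ℝ → ℝ} (hV : Continuous V) {μ : Measure ℝ}
    (hμ : IsEquilibriumMeasure V J μ) (hsupp : J ⊆ μ.support) {n : ℕ} (hn : n ≠ 0) :
    ∫ y, chebMode n y ∂μ =
      -(n / 2) * (π⁻¹ * ∫ θ in (0 : ℝ)..π, V (2 * cos θ) * cos (n * θ)) := by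
  have hn' : (n : ℝ) ≠ 0 := by exact_mod_cast hn
  have h := moment_identity hV hμ hsupp n
  have e : ∀ θ, (robin V μ - V (2 * cos θ)) / 2 * cos (n * θ) =
      robin V μ / 2 * cos (n * θ) - 2⁻¹ * (V (2 * cos θ) * cos (n * θ)) := fun θ => by ring
  simp only [e] at h
  rw [intervalIntegral.integral_sub (Continuous.intervalIntegrable (by fun_prop) _ _)
    (Continuous.intervalIntegrable (by fun_prop) _ _), intervalIntegral.integral_const_mul,
    intervalIntegral.integral_const_mul, integral_cos_nat_mul hn] at h
  field_simp at h ⊢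
  linarith

/-- Mode 0 determines the Robin constant: the shifted self-energy minus log 4 equals half of ∫ V dω
- ∫ V dμ. -/
theorem minEnergy_eq {V : ℝ → ℝ} (hV : Continuous V) {μ : Measure ℝ}
    (hμ : IsEquilibriumMeasure V J μ) (hsupp : J ⊆ μ.support) :
    minEnergy V J =
      (((∫ x, V x ∂μ + π⁻¹ * ∫ θ in (0 : ℝ)..π, V (2 * cos θ)) / 2 : ℝ) : EReal) := by
  have h := moment_identity hV hμ hsupp 0
  simp only [Nat.cast_zero, zero_mul, cos_zero, mul_one, div_zero, add_zero] at h
  rw [intervalIntegral.integral_div, intervalIntegral.integral_sub (by simp)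
    (Continuous.intervalIntegrable (by fun_prop) _ _)] at h
  simp only [intervalIntegral.integral_const, sub_zero, smul_eq_mul, mul_one] at h
  have h1 : minEnergy V J = energy V μ :=
    le_antisymm (iInf₂_le μ hμ.1) (le_iInf₂ hμ.2)
  rw [h1, energy_eq hμ.1]
  have hE := mutualEnergy_self_ne_top hμ
  unfold robin at h
  generalize mutualEnergy μ μ = E at *
  lift E to NNReal using hE
  rw [EReal.coe_nnreal_eq_coe_real, ← EReal.coe_add, ← EReal.coe_sub]
  congr 1
  rw [ENNReal.coe_toReal] at h
  field_simp at h ⊢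
  linarith

/-! ### Cosine coefficients under dilation -/

/-- The `n`-th cosine coefficient of `θ ↦ g (2 t cos θ)`. -/
def cosCoeff (g : ℝ → ℝ) (t : ℝ) (n : ℕ) : ℝ :=
  π⁻¹ * ∫ θ in (0 : ℝ)..π, g (t * (2 * cos θ)) * cos (n * θ)

theorem continuous_cosCoeff {g : ℝ → ℝ} (hg : Continuous g) (n : ℕ) :
    Continuous fun t => cosCoeff g t n := by
  refine continuous_const.mul ?_
  exact intervalIntegral.continuous_parametric_intervalIntegral_of_continuous' (by fun_prop) _ _

theorem mul_mem_J {t x : ℝ} (ht : t ∈ Icc (0 : ℝ) 1) (hx : x ∈ J) : t * x ∈ J := by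
  obtain ⟨h0, h1⟩ := ht
  obtain ⟨h2, h3⟩ := hx
  constructor <;> nlinarith

theorem exists_abs_cosCoeff_le {g : ℝ → ℝ} (hg : Continuous g) :
    ∃ C, 0 ≤ C ∧ ∀ t ∈ Icc (0 : ℝ) 1, ∀ n, |cosCoeff g t n| ≤ C := by
  obtain ⟨C, hC⟩ := (isCompact_Icc (a := (-2 : ℝ)) (b := 2)).exists_bound_of_continuousOn
    hg.continuousOn
  have hC0 : 0 ≤ C := (norm_nonneg _).trans (hC 0 (by norm_num))
  refine ⟨C, hC0, fun t ht n => ?_⟩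
  have h : ‖∫ θ in (0 : ℝ)..π, g (t * (2 * cos θ)) * cos (n * θ)‖ ≤ C * |π - 0| := by
    refine intervalIntegral.norm_integral_le_of_norm_le_const (fun θ _ => ?_)
    rw [norm_mul]
    calc _ ≤ C * 1 := mul_le_mul (hC _ (mul_mem_J ht (two_mul_cos_mem_J θ)))
            (abs_cos_le_one (n * θ)) (abs_nonneg _) hC0
      _ = C := mul_one C
  rw [sub_zero, abs_of_pos pi_pos, Real.norm_eq_abs] at h
  rw [cosCoeff, abs_mul, abs_of_pos (inv_pos.2 pi_pos), inv_mul_le_iff₀ pi_pos]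
  linarith

/-- Integration by parts in θ, with 2 sin θ sin((n+1)θ) = cos nθ - cos((n+2)θ). -/
theorem cosCoeff_succ {g g' : ℝ → ℝ} (hg : ∀ x, HasDerivAt g (g' x) x) (hg' : Continuous g')
    (t : ℝ) (n : ℕ) :
    (n + 1) * cosCoeff g t (n + 1) = t * (cosCoeff g' t n - cosCoeff g' t (n + 2)) := by
  have hgc : Continuous g := continuous_iff_continuousAt.2 fun x => (hg x).continuousAt
  have key := intervalIntegral.integral_eq_sub_of_hasDerivAt (a := 0) (b := π)
    (f := fun θ => g (t * (2 * cos θ)) * sin ((n + 1 : ℕ) * θ))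
    (f' := fun θ => (n + 1) * (g (t * (2 * cos θ)) * cos ((n + 1 : ℕ) * θ)) -
      (t * (g' (t * (2 * cos θ)) * cos (n * θ)) -
        t * (g' (t * (2 * cos θ)) * cos ((n + 2 : ℕ) * θ)))) ?_
    (Continuous.intervalIntegrable (by fun_prop) _ _)
  · simp only [sin_nat_mul_pi, mul_zero, sin_zero, sub_self] at key
    rw [intervalIntegral.integral_sub (Continuous.intervalIntegrable (by fun_prop) _ _)
      (Continuous.intervalIntegrable (by fun_prop) _ _),
      intervalIntegral.integral_sub (Continuous.intervalIntegrable (by fun_prop) _ _)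
      (Continuous.intervalIntegrable (by fun_prop) _ _)] at key
    simp only [intervalIntegral.integral_const_mul] at key
    unfold cosCoeff
    linear_combination π⁻¹ * key
  · intro θ _
    have h1 : HasDerivAt (fun θ => t * (2 * cos θ)) (t * (2 * -sin θ)) θ :=
      ((hasDerivAt_cos θ).const_mul 2).const_mul t
    have h2 := ((hg (t * (2 * cos θ))).comp θ h1).mul
      (((hasDerivAt_id θ).const_mul ((n + 1 : ℕ) : ℝ)).sin)
    refine h2.congr_deriv ?_
    have e1 : (n : ℝ) * θ = ((n + 1 : ℕ) : ℝ) * θ - θ := by push_cast; ring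
    have e2 : ((n + 2 : ℕ) : ℝ) * θ = ((n + 1 : ℕ) : ℝ) * θ + θ := by push_cast; ring
    simp only [e1, e2, cos_add, cos_sub, id, Function.comp]
    push_cast
    ring

theorem hasDerivAt_cosCoeff_aux {g g' : ℝ → ℝ} (hg : ∀ x, HasDerivAt g (g' x) x)
    (hg' : Continuous g') (t : ℝ) (n : ℕ) :
    HasDerivAt (fun t => cosCoeff g t n)
      (π⁻¹ * ∫ θ in (0 : ℝ)..π, g' (t * (2 * cos θ)) * (2 * cos θ) * cos (n * θ)) t := by
  have hgc : Continuous g := continuous_iff_continuousAt.2 fun x => (hg x).continuousAt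
  refine HasDerivAt.const_mul _ ?_
  -- This interval contains s · 2 cos θ for every s within distance 1 of t, giving a constant
  -- dominating function.
  obtain ⟨C, hC⟩ := (isCompact_Icc (a := -2 * (|t| + 1)) (b := 2 * (|t| + 1))
    ).exists_bound_of_continuousOn hg'.continuousOn
  refine (intervalIntegral.hasDerivAt_integral_of_dominated_loc_of_deriv_le
    (F := fun t θ => g (t * (2 * cos θ)) * cos (n * θ))
    (F' := fun t θ => g' (t * (2 * cos θ)) * (2 * cos θ) * cos (n * θ))
    (bound := fun _ => C * 2 * 1) (Metric.ball_mem_nhds t one_pos) ?_ ?_ ?_ ?_ ?_ ?_).2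
  · exact Eventually.of_forall fun s => Continuous.aestronglyMeasurable (by fun_prop)
  · exact Continuous.intervalIntegrable (by fun_prop) _ _
  · exact Continuous.aestronglyMeasurable (by fun_prop)
  · refine ae_of_all _ fun θ _ s hs => ?_
    have h1 : |s| ≤ |t| + 1 := by
      have h := abs_sub_abs_le_abs_sub s t
      rw [Metric.mem_ball, Real.dist_eq] at hs
      linarith
    have h2 : |2 * cos θ| ≤ 2 := by
      rw [abs_mul, abs_two]; linarith [abs_cos_le_one θ]
    have h3 : |s * (2 * cos θ)| ≤ 2 * (|t| + 1) := by
      rw [abs_mul, mul_comm 2 (|t| + 1)]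
      exact mul_le_mul h1 h2 (abs_nonneg _) (by positivity)
    have h4 := hC (s * (2 * cos θ)) (by rw [neg_mul]; exact abs_le.1 h3)
    rw [norm_mul, norm_mul]
    have hC0 := (norm_nonneg _).trans h4
    exact mul_le_mul (mul_le_mul h4 h2 (norm_nonneg _) hC0) (abs_cos_le_one _) (abs_nonneg _)
      (by positivity)
  · simp
  · refine ae_of_all _ fun θ _ s _ => ?_
    exact ((hg (s * (2 * cos θ))).comp s (hasDerivAt_mul_const (2 * cos θ))).mul_const _

theorem hasDerivAt_cosCoeff_succ {g g' : ℝ → ℝ} (hg : ∀ x, HasDerivAt g (g' x) x)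
    (hg' : Continuous g') (t : ℝ) (n : ℕ) :
    HasDerivAt (fun t => cosCoeff g t (n + 1)) (cosCoeff g' t n + cosCoeff g' t (n + 2)) t := by
  refine (hasDerivAt_cosCoeff_aux hg hg' t (n + 1)).congr_deriv ?_
  unfold cosCoeff
  rw [← mul_add, ← intervalIntegral.integral_add (Continuous.intervalIntegrable (by fun_prop) _ _)
    (Continuous.intervalIntegrable (by fun_prop) _ _)]
  congr 2
  ext θ
  have e1 : (n : ℝ) * θ = ((n + 1 : ℕ) : ℝ) * θ - θ := by push_cast; ring
  have e2 : ((n + 2 : ℕ) : ℝ) * θ = ((n + 1 : ℕ) : ℝ) * θ + θ := by push_cast; ring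
  rw [e1, e2, cos_add, cos_sub]
  ring

theorem hasDerivAt_cosCoeff_zero {g g' : ℝ → ℝ} (hg : ∀ x, HasDerivAt g (g' x) x)
    (hg' : Continuous g') (t : ℝ) :
    HasDerivAt (fun t => cosCoeff g t 0) (2 * cosCoeff g' t 1) t := by
  refine (hasDerivAt_cosCoeff_aux hg hg' t 0).congr_deriv ?_
  unfold cosCoeff
  rw [mul_left_comm (2 : ℝ), ← intervalIntegral.integral_const_mul (2 : ℝ)]
  congr 1
  refine intervalIntegral.integral_congr (fun θ _ => ?_)
  simp
  ring

theorem exists_abs_cosCoeff_succ_le {g g' : ℝ → ℝ} (hg : ∀ x, HasDerivAt g (g' x) x)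
    (hg' : Continuous g') :
    ∃ C, 0 ≤ C ∧ ∀ t ∈ Icc (0 : ℝ) 1, ∀ n : ℕ, |cosCoeff g t (n + 1)| ≤ C / (n + 1) := by
  obtain ⟨C, hC0, hC⟩ := exists_abs_cosCoeff_le hg'
  refine ⟨2 * C, by positivity, fun t ht n => ?_⟩
  have hn : (0 : ℝ) < n + 1 := by positivity
  rw [le_div_iff₀ hn, ← abs_of_pos hn, ← abs_mul, mul_comm, cosCoeff_succ hg hg', abs_mul,
    abs_of_nonneg ht.1]
  have h := abs_sub (cosCoeff g' t n) (cosCoeff g' t (n + 2))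
  have h1 := hC t ht n
  have h2 := hC t ht (n + 2)
  calc _ ≤ 1 * (2 * C) := mul_le_mul ht.2 (by linarith) (abs_nonneg _) zero_le_one
    _ = _ := one_mul _

/-- The product of the two recurrences is a difference of squares with index step two, so the sum
telescopes, leaving two terms at each end. At t = 0 all coefficients of positive index vanish. -/
theorem half_sum_sq_cosCoeff {f f' : ℝ → ℝ} (hf : ∀ x, HasDerivAt f (f' x) x)
    (hf' : Continuous f') (N : ℕ) :
    ∑ n ∈ Finset.range N, (n + 1) * cosCoeff f 1 (n + 1) ^ 2 / 2 =
      ∫ t in (0 : ℝ)..1, t * (cosCoeff f' t 0 ^ 2 + cosCoeff f' t 1 ^ 2 -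
        cosCoeff f' t N ^ 2 - cosCoeff f' t (N + 1) ^ 2) := by
  have hc : ∀ n, Continuous fun t => cosCoeff f' t n := continuous_cosCoeff hf'
  rw [intervalIntegral.integral_eq_sub_of_hasDerivAt
    (f := fun t => ∑ n ∈ Finset.range N, (n + 1) * cosCoeff f t (n + 1) ^ 2 / 2)]
  · have h0 : ∀ n : ℕ, cosCoeff f 0 (n + 1) = 0 := by
      intro n
      have h := cosCoeff_succ hf hf' 0 n
      rw [zero_mul] at h
      exact (mul_eq_zero.1 h).resolve_left (by positivity)
    simp [h0]
  · intro t _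
    have h : ∀ n ∈ Finset.range N, HasDerivAt (fun t => (n + 1) * cosCoeff f t (n + 1) ^ 2 / 2)
        (t * (cosCoeff f' t n ^ 2 - cosCoeff f' t (n + 2) ^ 2)) t := by
      intro n _
      have h1 := (((hasDerivAt_cosCoeff_succ hf hf' t n).pow 2).const_mul
        ((n : ℝ) + 1)).div_const 2
      refine h1.congr_deriv ?_
      have h2 := cosCoeff_succ hf hf' t n
      simp only [Nat.cast_ofNat, Nat.add_one_sub_one, pow_one]
      linear_combination (cosCoeff f' t n + cosCoeff f' t (n + 2)) * h2
    refine (HasDerivAt.fun_sum h).congr_deriv ?_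
    rw [← Finset.mul_sum]
    congr 1
    clear h
    induction N with
    | zero => simp
    | succ N ih => rw [Finset.sum_range_succ, ih]; ring
  · exact Continuous.intervalIntegrable (by fun_prop) _ _

theorem hasSum_half_sq_cosCoeff {f f' f'' : ℝ → ℝ} (hf : ∀ x, HasDerivAt f (f' x) x)
    (hf' : ∀ x, HasDerivAt f' (f'' x) x) (hf'' : Continuous f'') :
    HasSum (fun n : ℕ => (n + 1) * cosCoeff f 1 (n + 1) ^ 2 / 2)
      (∫ t in (0 : ℝ)..1, t * (cosCoeff f' t 1 ^ 2 + cosCoeff f' t 0 ^ 2)) := by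
  have hc' : Continuous f' := continuous_iff_continuousAt.2 fun x => (hf' x).continuousAt
  have hc : ∀ n, Continuous fun t => cosCoeff f' t n := continuous_cosCoeff hc'
  obtain ⟨C, hC0, hC⟩ := exists_abs_cosCoeff_succ_le hf' hf''
  rw [hasSum_iff_tendsto_nat_of_nonneg (fun n => by positivity)]
  simp only [half_sum_sq_cosCoeff hf hc']
  -- The decay bound holds only for positive indices, hence the shift; the end terms are then
  -- O(1/N²) uniformly in t.
  rw [← tendsto_add_atTop_iff_nat 1, tendsto_iff_norm_sub_tendsto_zero]
  have hlim : Tendsto (fun N : ℕ => 2 * (C / ((N : ℝ) + 1)) ^ 2) atTop (𝓝 0) := by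
    have h1 : Tendsto (fun N : ℕ => C / ((N : ℝ) + 1)) atTop (𝓝 0) :=
      tendsto_const_nhds.div_atTop (tendsto_natCast_atTop_atTop.atTop_add tendsto_const_nhds)
    simpa using (h1.pow 2).const_mul 2
  refine squeeze_zero (fun _ => norm_nonneg _) (fun N => ?_) hlim
  rw [← intervalIntegral.integral_sub (Continuous.intervalIntegrable (by fun_prop) _ _)
    (Continuous.intervalIntegrable (by fun_prop) _ _)]
  have h : ∀ t ∈ Ι (0 : ℝ) 1, ‖t * (cosCoeff f' t 0 ^ 2 + cosCoeff f' t 1 ^ 2 -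
      cosCoeff f' t (N + 1) ^ 2 - cosCoeff f' t (N + 1 + 1) ^ 2) -
      t * (cosCoeff f' t 1 ^ 2 + cosCoeff f' t 0 ^ 2)‖ ≤ 2 * (C / ((N : ℝ) + 1)) ^ 2 := by
    intro t ht
    rw [uIoc_of_le zero_le_one] at ht
    have ht' := Ioc_subset_Icc_self ht
    have h1 := hC t ht' N
    have h2 := hC t ht' (N + 1)
    have h3 : C / (((N + 1 : ℕ) : ℝ) + 1) ≤ C / ((N : ℝ) + 1) := by
      push_cast; gcongr; linarith
    have h4 := sq_le_sq' (abs_le.1 h1).1 (abs_le.1 h1).2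
    have h5 := sq_le_sq' (abs_le.1 (h2.trans h3)).1 (abs_le.1 (h2.trans h3)).2
    have e : t * (cosCoeff f' t 0 ^ 2 + cosCoeff f' t 1 ^ 2 -
      cosCoeff f' t (N + 1) ^ 2 - cosCoeff f' t (N + 1 + 1) ^ 2) -
      t * (cosCoeff f' t 1 ^ 2 + cosCoeff f' t 0 ^ 2) =
      -(t * (cosCoeff f' t (N + 1) ^ 2 + cosCoeff f' t (N + 1 + 1) ^ 2)) := by ring
    rw [e, norm_neg, norm_mul, Real.norm_eq_abs, Real.norm_eq_abs, abs_of_pos ht.1,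
      abs_of_nonneg (by positivity)]
    calc _ ≤ 1 * (2 * (C / ((N : ℝ) + 1)) ^ 2) :=
          mul_le_mul ht.2 (by linarith) (by positivity) zero_le_one
      _ = _ := one_mul _
  simpa using intervalIntegral.norm_integral_le_of_norm_le_const h

/-! ### Fourier series and Parseval's identity -/

theorem integral_neg_pi_pi_of_even {E : Type*} [NormedAddCommGroup E] [NormedSpace ℝ E]
    {F : ℝ → E} (hF : Continuous F) :
    ∫ x in (-π)..π, F x = ∫ x in (0 : ℝ)..π, (F x + F (-x)) := by
  have h := intervalIntegral.integral_comp_neg (a := 0) (b := π) F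
  rw [neg_zero] at h
  have hn : Continuous fun x => F (-x) := hF.comp continuous_neg
  rw [intervalIntegral.integral_add (hF.intervalIntegrable _ _)
    (hn.intervalIntegrable _ _), h, add_comm,
    intervalIntegral.integral_add_adjacent_intervals (hF.intervalIntegrable _ _)
      (hF.intervalIntegrable _ _)]

theorem periodic_comp_two_mul_cos (g : ℝ → ℝ) :
    Function.Periodic (fun θ => ((g (2 * cos θ) : ℝ) : ℂ)) (2 * π) := fun θ => by
  simp only [cos_add_two_pi]

/-- The function `θ ↦ g (2 cos θ)` on the circle. -/
def circleLift {g : ℝ → ℝ} (hg : Continuous g) : C(AddCircle (2 * π), ℂ) :=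
  ⟨(periodic_comp_two_mul_cos g).lift, continuous_coinduced_dom.2 (by
    have : Continuous fun θ => ((g (2 * cos θ) : ℝ) : ℂ) := by fun_prop
    exact this)⟩

theorem circleLift_coe {g : ℝ → ℝ} (hg : Continuous g) (x : ℝ) :
    circleLift hg (x : AddCircle (2 * π)) = (g (2 * cos x) : ℂ) := rfl

instance : Fact (0 < 2 * π) := ⟨two_pi_pos⟩

theorem fourier_two_pi_apply (n : ℤ) (x : ℝ) :
    fourier n (x : AddCircle (2 * π)) = (cos (n * x) : ℂ) + (sin (n * x) : ℂ) * Complex.I := by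
  rw [fourier_coe_apply]
  have : 2 * π * Complex.I * n * x / (2 * π : ℝ) = ((n * x : ℝ) : ℂ) * Complex.I := by
    have hpi : (π : ℂ) ≠ 0 := by exact_mod_cast pi_ne_zero
    push_cast
    field_simp
  rw [this, Complex.exp_mul_I]
  push_cast
  rfl

theorem fourierCoeff_circleLift {g : ℝ → ℝ} (hg : Continuous g) (n : ℤ) :
    fourierCoeff (circleLift hg) n = (cosCoeff g 1 n.natAbs : ℂ) := by
  rw [fourierCoeff_eq_intervalIntegral _ _ (-π), show -π + 2 * π = π by ring]
  have h1 : ∀ x : ℝ, fourier (-n) (x : AddCircle (2 * π)) • circleLift hg (x : AddCircle (2 * π))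
      = ((cos (n * x) : ℂ) - (sin (n * x) : ℂ) * Complex.I) * (g (2 * cos x) : ℂ) := by
    intro x
    rw [fourier_two_pi_apply, smul_eq_mul]
    push_cast
    simp [neg_mul, Complex.cos_neg, Complex.sin_neg, circleLift_coe, sub_eq_add_neg]
  simp only [h1]
  rw [integral_neg_pi_pi_of_even (by fun_prop)]
  have habs : ∀ x : ℝ, cos (n.natAbs * x) = cos (n * x) := by
    intro x
    rcases Int.natAbs_eq n with h | h
    · conv_rhs => rw [h]
      simp
    · conv_rhs => rw [h]
      simp [cos_neg]
  have h2 : ∀ x : ℝ, ((cos (n * x) : ℂ) - (sin (n * x) : ℂ) * Complex.I) * (g (2 * cos x) : ℂ) +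
      ((cos (n * -x) : ℂ) - (sin (n * -x) : ℂ) * Complex.I) * (g (2 * cos (-x)) : ℂ) =
      ((2 * (g (1 * (2 * cos x)) * cos (n.natAbs * x)) : ℝ) : ℂ) := by
    intro x
    rw [habs, mul_neg, cos_neg, sin_neg, cos_neg, one_mul]
    push_cast
    ring
  simp only [h2]
  rw [intervalIntegral.integral_ofReal, intervalIntegral.integral_const_mul, cosCoeff,
    Complex.real_smul, ← Complex.ofReal_mul]
  congr 1
  field_simp

/-- Two integrations by parts give decay O(1/n²). -/
theorem summable_abs_cosCoeff {f f' f'' : ℝ → ℝ} (hf : ∀ x, HasDerivAt f (f' x) x)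
    (hf' : ∀ x, HasDerivAt f' (f'' x) x) (hf'' : Continuous f'') :
    Summable (fun n => |cosCoeff f 1 n|) := by
  have hc' : Continuous f' := continuous_iff_continuousAt.2 fun x => (hf' x).continuousAt
  obtain ⟨C, hC0, hC⟩ := exists_abs_cosCoeff_succ_le hf' hf''
  rw [← summable_nat_add_iff 2]
  have hs : Summable fun n : ℕ => 2 * C * (1 / ((n + 1 : ℕ) : ℝ) ^ 2) :=
    ((summable_nat_add_iff 1).2 (Real.summable_one_div_nat_pow.2 one_lt_two)).mul_left _
  refine Summable.of_nonneg_of_le (fun _ => abs_nonneg _) (fun n => ?_) hs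
  have h := cosCoeff_succ hf hc' 1 (n + 1)
  have hI : (1 : ℝ) ∈ Icc (0 : ℝ) 1 := by simp
  have h1 := hC 1 hI n
  have h2 := hC 1 hI (n + 2)
  have hn : (0 : ℝ) < n + 1 := by positivity
  have h3 : C / (((n + 2 : ℕ) : ℝ) + 1) ≤ C / ((n : ℝ) + 1) := by
    push_cast; gcongr; linarith
  have h4 : (((n + 1 : ℕ) : ℝ) + 1) * |cosCoeff f 1 (n + 2)| ≤ 2 * (C / (n + 1)) := by
    rw [← abs_of_pos (by positivity : (0 : ℝ) < ((n + 1 : ℕ) : ℝ) + 1), ← abs_mul, h, one_mul]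
    have h5 := abs_sub (cosCoeff f' 1 (n + 1)) (cosCoeff f' 1 (n + 1 + 2))
    have h6 : |cosCoeff f' 1 (n + 1 + 2)| ≤ _ := h2
    linarith
  have h5 : (n + 1) * |cosCoeff f 1 (n + 2)| ≤ 2 * (C / (n + 1)) := by
    refine le_trans ?_ h4
    push_cast
    gcongr
    linarith
  rw [mul_comm, ← le_div_iff₀ hn] at h5
  refine h5.trans (le_of_eq ?_)
  push_cast
  field_simp

/-- The Chebyshev expansion of a `C²` function. -/
theorem hasSum_chebMode {f f' f'' : ℝ → ℝ} (hf : ∀ x, HasDerivAt f (f' x) x)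
    (hf' : ∀ x, HasDerivAt f' (f'' x) x) (hf'' : Continuous f'') {y : ℝ} (hy : y ∈ J) :
    HasSum (fun n : ℕ => 2 * cosCoeff f 1 n * chebMode n y) (f y + cosCoeff f 1 0) := by
  have hc : Continuous f := continuous_iff_continuousAt.2 fun x => (hf x).continuousAt
  obtain ⟨φ, hφ, rfl⟩ := exists_two_mul_cos_eq hy
  have hs := summable_abs_cosCoeff hf hf' hf''
  have hsum : Summable (fourierCoeff (circleLift hc)) := by
    have h1 : Summable fun n : ℕ => (cosCoeff f 1 n : ℂ) := by
      refine Summable.of_norm ?_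
      simpa using hs
    refine Summable.of_nat_of_neg ?_ ?_ <;> simpa [fourierCoeff_circleLift] using h1
  have h := has_pointwise_sum_fourier_series_of_summable hsum (φ : AddCircle (2 * π))
  -- Pairing n with -n counts the constant mode twice, whence the extra `cosCoeff f 1 0` in the sum.
  have h2 := Complex.reCLM.hasSum h.nat_add_neg
  have e1 : Complex.reCLM (circleLift hc (φ : AddCircle (2 * π)) + fourierCoeff (circleLift hc) 0 •
      fourier 0 (φ : AddCircle (2 * π))) = f (2 * cos φ) + cosCoeff f 1 0 := by
    rw [fourierCoeff_circleLift, circleLift_coe, fourier_zero]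
    simp
  rw [e1] at h2
  convert h2 using 2 with n
  rw [fourierCoeff_circleLift, fourierCoeff_circleLift, fourier_two_pi_apply,
    fourier_two_pi_apply, chebMode_two_mul_cos n hφ, Int.natAbs_neg, Int.natAbs_natCast,
    ← smul_add]
  have e2 : ((cos (((n : ℕ) : ℤ) * φ) : ℂ) + (sin (((n : ℕ) : ℤ) * φ) : ℂ) * Complex.I +
      ((cos ((-((n : ℕ) : ℤ) : ℤ) * φ) : ℂ) + (sin ((-((n : ℕ) : ℤ) : ℤ) * φ) : ℂ) * Complex.I)) =
      ((2 * cos (n * φ) : ℝ) : ℂ) := by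
    push_cast
    simp only [neg_mul, Complex.cos_neg, Complex.sin_neg]
    ring
  rw [e2, smul_eq_mul, ← Complex.ofReal_mul, Complex.reCLM_apply, Complex.ofReal_re]
  ring

/-- Parseval's identity for the pairing of a `C²` potential with its equilibrium measure. -/
theorem hasSum_integral_equilibrium {f f' f'' : ℝ → ℝ} (hf : ∀ x, HasDerivAt f (f' x) x)
    (hf' : ∀ x, HasDerivAt f' (f'' x) x) (hf'' : Continuous f'') {μ : Measure ℝ}
    (hμ : IsEquilibriumMeasure f J μ) (hsupp : J ⊆ μ.support) :
    HasSum (fun n : ℕ => -((n + 1) * cosCoeff f 1 (n + 1) ^ 2))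
      (∫ x, f x ∂μ - cosCoeff f 1 0) := by
  have := hμ.1.1
  have hc : Continuous f := continuous_iff_continuousAt.2 fun x => (hf x).continuousAt
  have hs := summable_abs_cosCoeff hf hf' hf''
  have h := hasSum_integral_of_summable_integral_norm (μ := μ)
    (F := fun (n : ℕ) y => 2 * cosCoeff f 1 n * chebMode n y)
    (fun n => (integrable_of_continuous hμ.1 (continuous_chebMode n)).const_mul _) (by
      refine Summable.of_nonneg_of_le (fun n => integral_nonneg fun _ => norm_nonneg _)
        (fun n => ?_) (hs.mul_left 2)
      have h1 : ∀ y, ‖2 * cosCoeff f 1 n * chebMode n y‖ ≤ 2 * |cosCoeff f 1 n| := by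
        intro y
        rw [norm_mul, norm_mul, Real.norm_eq_abs, Real.norm_eq_abs, Real.norm_eq_abs, abs_two]
        exact mul_le_of_le_one_right (by positivity) (abs_chebMode_le n y)
      calc _ ≤ ∫ _, 2 * |cosCoeff f 1 n| ∂μ := integral_mono_of_nonneg
            (ae_of_all _ fun _ => norm_nonneg _) (integrable_const _) (ae_of_all _ h1)
        _ = _ := by simp)
  have h2 : ∫ y, (∑' n : ℕ, 2 * cosCoeff f 1 n * chebMode n y) ∂μ =
      ∫ y, f y ∂μ + cosCoeff f 1 0 := by
    rw [integral_congr_ae (g := fun y => f y + cosCoeff f 1 0)]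
    · rw [integral_add (integrable_of_continuous hμ.1 hc) (integrable_const _)]
      simp
    · filter_upwards [ae_mem_J hμ.1] with y hy using (hasSum_chebMode hf hf' hf'' hy).tsum_eq
  -- Removing the doubled constant mode 2 a_0 turns ∫ f dμ + a_0 into ∫ f dμ - a_0.
  rw [h2, ← hasSum_nat_add_iff' 1] at h
  have e1 : (fun n : ℕ => ∫ y, 2 * cosCoeff f 1 (n + 1) * chebMode (n + 1) y ∂μ) =
      fun n : ℕ => -((n + 1) * cosCoeff f 1 (n + 1) ^ 2) := by
    ext n
    rw [integral_const_mul, integral_chebMode_equilibrium hc hμ hsupp (Nat.succ_ne_zero n)]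
    have : cosCoeff f 1 (n + 1) =
        π⁻¹ * ∫ θ in (0 : ℝ)..π, f (2 * cos θ) * cos ((n + 1 : ℕ) * θ) := by
      simp only [cosCoeff, one_mul]
    rw [← this]
    push_cast
    ring
  have e2 : ∫ x, f x ∂μ - cosCoeff f 1 0 = ∫ x, f x ∂μ + cosCoeff f 1 0 -
      ∑ i ∈ Finset.range 1, ∫ y, 2 * cosCoeff f 1 i * chebMode i y ∂μ := by
    simp [chebMode_zero]
    ring
  rw [e2, ← e1]
  exact h

/-! ### The energy through cosine coefficients -/

theorem minEnergy_eq_cosCoeff {f f' f'' : ℝ → ℝ} (hf : ∀ x, HasDerivAt f (f' x) x)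
    (hf' : ∀ x, HasDerivAt f' (f'' x) x) (hf'' : Continuous f'') {μ : Measure ℝ}
    (hμ : IsEquilibriumMeasure f J μ) (hsupp : J ⊆ μ.support) :
    minEnergy f J = ((cosCoeff f 1 0 -
      ∫ t in (0 : ℝ)..1, t * (cosCoeff f' t 1 ^ 2 + cosCoeff f' t 0 ^ 2) : ℝ) : EReal) := by
  have hc : Continuous f := continuous_iff_continuousAt.2 fun x => (hf x).continuousAt
  rw [minEnergy_eq hc hμ hsupp]
  congr 1
  have h1 := (hasSum_integral_equilibrium hf hf' hf'' hμ hsupp).neg.div_const 2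
  simp only [neg_neg] at h1
  have h2 := h1.unique (hasSum_half_sq_cosCoeff hf hf' hf'')
  have h3 : cosCoeff f 1 0 = π⁻¹ * ∫ θ in (0 : ℝ)..π, f (2 * cos θ) := by
    simp [cosCoeff]
  rw [← h2, ← h3]
  ring

/-- The arcsine mean of f(t·) equals f(0) at t = 0; integrating its t-derivative links the two
stated formulas. -/
theorem integral_cosCoeff_one {f f' : ℝ → ℝ} (hf : ∀ x, HasDerivAt f (f' x) x)
    (hf' : Continuous f') :
    cosCoeff f 1 0 = f 0 + ∫ t in (0 : ℝ)..1, 2 * cosCoeff f' t 1 := by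
  have hc := continuous_cosCoeff hf' 1
  rw [intervalIntegral.integral_eq_sub_of_hasDerivAt (f := fun t => cosCoeff f t 0)
    (fun t _ => hasDerivAt_cosCoeff_zero hf hf' t)
    (Continuous.intervalIntegrable (by fun_prop) _ _)]
  have : cosCoeff f 0 0 = f 0 := by
    simp [cosCoeff]
  rw [this]
  ring

/-! ### Extension of the potential to the line -/

theorem exists_continuous_primitive_extension {g h : ℝ → ℝ}
    (hg : ∀ x ∈ J, HasDerivWithinAt g (h x) J x) (hh : Continuous h) :
    ∃ G : ℝ → ℝ, (∀ x, HasDerivAt G (h x) x) ∧ EqOn G g J := by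
  have hd : ∀ x, HasDerivAt (fun x => g (-2) + ∫ u in (-2 : ℝ)..x, h u) (h x) x := fun x =>
    (intervalIntegral.integral_hasDerivAt_right (hh.intervalIntegrable _ _)
      (hh.stronglyMeasurableAtFilter _ _) hh.continuousAt).const_add _
  refine ⟨_, hd, fun x hx => ?_⟩
  have hsub : Icc (-2) x ⊆ J := Icc_subset_Icc_right hx.2
  rw [intervalIntegral.integral_eq_sub_of_hasDerivAt_of_le (f := g) hx.1
    (fun y hy => ((hg y (hsub hy)).continuousWithinAt).mono hsub)
    (fun y hy => (hg y (hsub (Ioo_subset_Icc_self hy))).hasDerivAt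
      (Icc_mem_nhds hy.1 (hy.2.trans_le hx.2)))
    (hh.intervalIntegrable _ _)]
  ring

/-- A `C²` function on `[-2, 2]` extends to a `C²` function on the line. -/
theorem exists_contDiff_extension {V : ℝ → ℝ} (hV : ContDiffOn ℝ 2 V J) :
    ∃ f f' f'' : ℝ → ℝ, (∀ x, HasDerivAt f (f' x) x) ∧ (∀ x, HasDerivAt f' (f'' x) x) ∧
      Continuous f'' ∧ EqOn f V J ∧ EqOn f' (derivJ V) J := by
  have hu : UniqueDiffOn ℝ J := uniqueDiffOn_Icc (by norm_num)
  have h1 : ContDiffOn ℝ 1 (derivJ V) J := hV.derivWithin hu (by norm_num)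
  have h2 : ContinuousOn (derivWithin (derivJ V) J) J := h1.continuousOn_derivWithin hu le_rfl
  have hle : (-2 : ℝ) ≤ 2 := by norm_num
  -- The second derivative is extended by constants beyond the end points and then integrated twice.
  set f'' := IccExtend hle ((Icc (-2 : ℝ) 2).domRestrict (derivWithin (derivJ V) J)) with hf''
  have hcf'' : Continuous f'' := h2.domRestrict.Icc_extend'
  have hd1 : ∀ x ∈ J, HasDerivWithinAt (derivJ V) (f'' x) J x := by
    intro x hx
    rw [hf'', IccExtend_of_mem hle _ hx]
    exact ((h1.differentiableOn one_ne_zero) x hx).hasDerivWithinAt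
  obtain ⟨f', hf', heq'⟩ := exists_continuous_primitive_extension hd1 hcf''
  have hcf' : Continuous f' := continuous_iff_continuousAt.2 fun x => (hf' x).continuousAt
  have hd0 : ∀ x ∈ J, HasDerivWithinAt V (f' x) J x := by
    intro x hx
    rw [heq' hx]
    exact ((hV.differentiableOn (by norm_num)) x hx).hasDerivWithinAt
  obtain ⟨f, hf, heq⟩ := exists_continuous_primitive_extension hd0 hcf'
  exact ⟨f, f', f'', hf, hf', hcf'', heq, heq'⟩

/-! ### Translation to the stated integrals -/

theorem energy_congr {f V : ℝ → ℝ} (h : EqOn f V J) {ν : Measure ℝ} (hν : ν ∈ probOn J) :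
    energy f ν = energy V ν := by
  have : ∫ x, f x ∂ν = ∫ x, V x ∂ν := integral_congr_ae (by
    filter_upwards [ae_mem_J hν] with x hx using h hx)
  rw [energy, energy, this]

theorem minEnergy_congr {f V : ℝ → ℝ} (h : EqOn f V J) : minEnergy f J = minEnergy V J :=
  iInf_congr fun _ => iInf_congr fun hν => energy_congr h hν

theorem arcsineIntegral_eq_cosCoeff {g h : ℝ → ℝ} {t : ℝ} {n : ℕ}
    (H : ∀ θ, h (2 * cos θ) = g (t * (2 * cos θ)) * cos (n * θ)) :
    arcsineIntegral h = cosCoeff g t n := by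
  simp only [arcsineIntegral_eq_integral_cos, H, cosCoeff]

theorem arcsineIntegral_derivJ {V f' : ℝ → ℝ} (h : EqOn f' (derivJ V) J) {t : ℝ}
    (ht : t ∈ Icc (0 : ℝ) 1) :
    arcsineIntegral (fun x => derivJ V (t * x)) = cosCoeff f' t 0 := by
  refine arcsineIntegral_eq_cosCoeff fun θ => ?_
  rw [h (mul_mem_J ht (two_mul_cos_mem_J θ))]
  simp

theorem arcsineIntegral_mul_derivJ {V f' : ℝ → ℝ} (h : EqOn f' (derivJ V) J) {t : ℝ}
    (ht : t ∈ Icc (0 : ℝ) 1) :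
    arcsineIntegral (fun x => x * derivJ V (t * x) / 2) = cosCoeff f' t 1 := by
  refine arcsineIntegral_eq_cosCoeff fun θ => ?_
  rw [h (mul_mem_J ht (two_mul_cos_mem_J θ)), Nat.cast_one, one_mul]
  ring

theorem arcsineIntegral_const_mul (c : ℝ) (h : ℝ → ℝ) :
    arcsineIntegral (fun x => c * h x) = c * arcsineIntegral h := by
  simp only [arcsineIntegral_eq_integral_cos, intervalIntegral.integral_const_mul]
  ring

theorem integrand₁_eq {V f' : ℝ → ℝ} (h : EqOn f' (derivJ V) J) {t : ℝ}
    (ht : t ∈ Icc (0 : ℝ) 1) :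
    integrand₁ V t = t * (cosCoeff f' t 1 ^ 2 + cosCoeff f' t 0 ^ 2) := by
  rw [integrand₁, arcsineIntegral_derivJ h ht, arcsineIntegral_mul_derivJ h ht]

/-- Expanding the square cancels the -1 and the factor 1/t. The second integrand differs from the
first only by the derivative of the arcsine mean of V(t·). -/
theorem integrand₂_eq {V f' : ℝ → ℝ} (h : EqOn f' (derivJ V) J) {t : ℝ}
    (ht : t ∈ Ioc (0 : ℝ) 1) :
    integrand₂ V t =
      t * (cosCoeff f' t 1 ^ 2 + cosCoeff f' t 0 ^ 2) - 2 * cosCoeff f' t 1 := by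
  have e : (fun x => t * x * derivJ V (t * x) / 2) =
      fun x => t * (x * derivJ V (t * x) / 2) := by ext x; ring
  rw [integrand₂, e, arcsineIntegral_const_mul, arcsineIntegral_const_mul,
    arcsineIntegral_derivJ h (Ioc_subset_Icc_self ht),
    arcsineIntegral_mul_derivJ h (Ioc_subset_Icc_self ht)]
  have := ht.1.ne'
  field_simp
  ring

end LogPotential

end

theorem theoremt (V : ℝ → ℝ)
    (hV2 : ContDiffOn ℝ 2 V LogPotential.J)
    (hV3 : LogPotential.PiecewiseContDiffOn 3 V (-2) 2)
    (μ : Measure ℝ)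
    (hμ : LogPotential.IsEquilibriumMeasure V LogPotential.J μ)
    (hsupp : μ.support = LogPotential.J) :
    LogPotential.ArcsineIntegrable V ∧
    (∀ t ∈ Icc (0 : ℝ) 1,
      LogPotential.ArcsineIntegrable (fun x => LogPotential.derivJ V (t * x)) ∧
      LogPotential.ArcsineIntegrable (fun x => x * LogPotential.derivJ V (t * x))) ∧
    IntervalIntegrable (LogPotential.integrand₁ V) volume 0 1 ∧
    IntervalIntegrable (LogPotential.integrand₂ V) volume 0 1 ∧
    LogPotential.minEnergy V LogPotential.J =
      ((LogPotential.arcsineIntegral V -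
        ∫ t in (0 : ℝ)..1, LogPotential.integrand₁ V t : ℝ) : EReal) ∧
    LogPotential.minEnergy V LogPotential.J =
      ((V 0 - ∫ t in (0 : ℝ)..1, LogPotential.integrand₂ V t : ℝ) : EReal) := by
  open LogPotential in
  obtain ⟨f, f', f'', hf, hf', hf'', heq, heq'⟩ := exists_contDiff_extension hV2
  have hc' : Continuous f' := continuous_iff_continuousAt.2 fun x => (hf' x).continuousAt
  have hc : ∀ n, Continuous fun t => cosCoeff f' t n := continuous_cosCoeff hc'
  have hmaps : ∀ t ∈ Icc (0 : ℝ) 1, ContinuousOn (fun x => derivJ V (t * x)) J := by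
    intro t ht
    have h1 : ContinuousOn (fun x => f' (t * x)) J := by fun_prop
    exact h1.congr fun x hx => (heq' (mul_mem_J ht hx)).symm
  have h₁ : ∀ t ∈ Set.uIoc (0 : ℝ) 1, t * (cosCoeff f' t 1 ^ 2 + cosCoeff f' t 0 ^ 2) =
      integrand₁ V t := fun t ht =>
    (integrand₁_eq heq' (Ioc_subset_Icc_self (by rwa [uIoc_of_le zero_le_one] at ht))).symm
  have h₂ : ∀ t ∈ Set.uIoc (0 : ℝ) 1, t * (cosCoeff f' t 1 ^ 2 + cosCoeff f' t 0 ^ 2) -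
      2 * cosCoeff f' t 1 = integrand₂ V t := fun t ht =>
    (integrand₂_eq heq' (by rwa [uIoc_of_le zero_le_one] at ht)).symm
  have hi₁ : IntervalIntegrable (fun t => t * (cosCoeff f' t 1 ^ 2 + cosCoeff f' t 0 ^ 2))
      volume 0 1 := Continuous.intervalIntegrable (by fun_prop) _ _
  have hi₂ : IntervalIntegrable (fun t => 2 * cosCoeff f' t 1) volume 0 1 :=
    Continuous.intervalIntegrable (by fun_prop) _ _
  have hμf : IsEquilibriumMeasure f J μ := by
    refine ⟨hμ.1, fun ν hν => ?_⟩
    rw [energy_congr heq hμ.1, energy_congr heq hν]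
    exact hμ.2 ν hν
  have hmin := minEnergy_eq_cosCoeff hf hf' hf'' hμf hsupp.ge
  rw [minEnergy_congr heq] at hmin
  refine ⟨arcsineIntegrable_of_continuousOn hV2.continuousOn, fun t ht =>
    ⟨arcsineIntegrable_of_continuousOn (hmaps t ht),
      arcsineIntegrable_of_continuousOn (continuousOn_id.mul (hmaps t ht))⟩,
    hi₁.congr h₁, (hi₁.sub hi₂).congr h₂, ?_, ?_⟩
  · have hV : arcsineIntegral V = cosCoeff f 1 0 := by
      refine arcsineIntegral_eq_cosCoeff fun θ => ?_
      rw [one_mul, heq (two_mul_cos_mem_J θ)]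
      simp
    rw [hmin, hV, intervalIntegral.integral_congr_ae (ae_of_all _ h₁)]
  · rw [hmin, ← intervalIntegral.integral_congr_ae (ae_of_all _ h₂),
      intervalIntegral.integral_sub hi₁ hi₂, integral_cosCoeff_one hf hc',
      heq (show (0 : ℝ) ∈ J by constructor <;> norm_num)]
    congr 1
    ring
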